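/- Setting. Let $\ell_2$ be the space of real square-summable sequences. A gossip matrix on a connected simple graph with vertex set $\{1,\dots,n\}$, $n\ge 2$, is a symmetric positive semi-definite matrix $W\in\mathbb R^{n\times n}$ whose kernel is $\mathrm{Span}(1,\dots,1)$ and with $W_{ij}\neq 0$ only if $i=j$ or $(i,j)$ is an edge. If $\lambda_1(W)\ge\dots\ge\lambda_n(W)=0$ are its eigenvalues, its eigengap is $\gamma(W)=\lambda_{n-1}(W)/\lambda_1(W)$. For $f_1,\dots,f_n:\ell_2\to\mathbb R$ let $\bar f=\frac1n\sum_{i=1}^n f_i$, let $\nabla f_i$ be the gradient, and let $f_i^*(y)=\sup_x(\langle y,x\rangle-f_i(x))$. Given $\tau>0$ (the time of one communication; one local computation takes time $1$), a black-box procedure using $W$ produces, for each node $i$ and each real time $t\ge0$, a memory $\mathcal M_{i,t}\subset\ell_2$ and an output $\theta_{i,t}\in\mathcal M_{i,t}$ such that $\mathcal M_{i,0}=\{0\}$ and, for all $t>0$, $\mathcal M_{i,t}\subset\mathcal M^{comp}_{i,t}\cup\mathcal M^{comm}_{i,t}$, where $$\mathcal M^{comp}_{i,t}=\mathrm{Span}\{\theta,\nabla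 f_i(\theta),\nabla f_i^*(\theta):\theta\in\mathcal M_{i,t-1}\},$$ $$\mathcal M^{comm}_{i,t}=\mathrm{Span}\Big\{\sum_{j=1}^n W_{ij}x_j : x_j\in\mathcal M_{j,t-\tau}\cup\{0\}\text{ for all } j\Big\},$$ with $\mathcal M_{i,s}=\emptyset$ for $s<0$ (and $\mathrm{Span}\,\emptyset=\{0\}$). Theorem. Let $\beta\ge\alpha>0$, $\kappa_l=\beta/\alpha$ and $\gamma\in(0,1]$. There exist $n\ge 2$, a connected simple graph on $n$ vertices, a gossip matrix $W$ on it with $\gamma(W)=\gamma$, and $\alpha$-strongly convex, $\beta$-smooth functions $f_1,\dots,f_n:\ell_2\to\mathbb R$ such that $\bar f$ has a minimizer $\theta^*\neq 0$ and such that, for every $\tau>0$, every black-box procedure using $W$, every $t\ge 0$ and every $i\in\{1,\dots,n\}$, $$\bar f(\theta_{i,t})-\bar f(\theta^*)\ \ge\ \frac{3\alpha}{2}\Big(\max\Big\{0,\,1-\frac{16}{\sqrt{\kappa_l}}\Big\}\Big)^{1+\frac{t}{1+\tau/(5\sqrt\gamma)}}\ \|\theta_{i,0}-\theta^*\|^2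 .$$ -/

import Mathlib

noncomputable section

/-- The Hilbert space of real square-summable sequences. -/
abbrev L2Seq : Type := lp (fun _ : ℕ => ℝ) 2

/-- `f` is `β`-smooth: differentiable with `β`-Lipschitz gradient. -/
def IsSmoothFun (β : ℝ) (f : L2Seq → ℝ) : Prop :=
  Differentiable ℝ f ∧ ∀ x y : L2Seq, ‖gradient f x - gradient f y‖ ≤ β * ‖x - y‖

/-- The Fenchel conjugate `f*(y) = sup_x (⟪y, x⟫ - f x)`. It is only used for strongly convex,
smooth `f`, for which the supremum is finite and `f*` is differentiable everywhere. -/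
def fenchelConj (f : L2Seq → ℝ) (y : L2Seq) : ℝ :=
  ⨆ x : L2Seq, (inner ℝ y x - f x)

/-- The global objective: the average of the local functions. -/
def avgFun {n : ℕ} (f : Fin n → L2Seq → ℝ) (x : L2Seq) : ℝ :=
  (1 / (n : ℝ)) * ∑ i, f i x

/-- `W` is a gossip matrix on the network `G`. -/
structure IsGossipMatrix {n : ℕ} (G : SimpleGraph (Fin n)) (W : Matrix (Fin n) (Fin n) ℝ) :
    Prop where
  /-- `W` is symmetric. -/
  isHermitian : W.IsHermitian
  /-- `W` is positive semi-definite. -/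
  posSemidef : W.PosSemidef
  /-- The kernel of `W` is the set of constant vectors. -/
  ker_eq : LinearMap.ker (Matrix.toLin' W) = Submodule.span ℝ {(fun _ => 1 : Fin n → ℝ)}
  /-- `W` is supported on the edges of the network and on the diagonal. -/
  edges : ∀ i j, W i j ≠ 0 → i = j ∨ G.Adj i j

/-- The normalized eigengap: the second smallest eigenvalue divided by the largest one.
`eigenvalues₀` lists the eigenvalues, with multiplicity, in non-increasing order. -/
def eigengap {n : ℕ} (hn : 2 ≤ n) {W : Matrix (Fin n) (Fin n) ℝ} (hW : W.IsHermitian) : ℝ :=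
  hW.eigenvalues₀ ⟨n - 2, by simp only [Fintype.card_fin]; omega⟩ /
    hW.eigenvalues₀ ⟨0, by simp only [Fintype.card_fin]; omega⟩

/-- What a node with local function `g` can obtain by one local computation from the memory
`S`: linear combinations of stored values, of gradients of `g` and of gradients of `g*` at stored
values. -/
def compSpan (g : L2Seq → ℝ) (S : Set L2Seq) : Submodule ℝ L2Seq :=
  Submodule.span ℝ
    (S ∪ (fun x => gradient g x) '' S ∪ (fun x => gradient (fenchelConj g) x) '' S)

/-- What node `i` can obtain by one communication through multiplication by `W`: linear
combinations of `∑ j, W i j • x j`, where each node `j` shares a value `x j` from its memory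
`S j` (or shares nothing, `x j = 0`). -/
def commSpan {n : ℕ} (W : Matrix (Fin n) (Fin n) ℝ) (S : Fin n → Set L2Seq) (i : Fin n) :
    Submodule ℝ L2Seq :=
  Submodule.span ℝ
    {v | ∃ x : Fin n → L2Seq, (∀ j, x j = 0 ∨ x j ∈ S j) ∧ v = ∑ j, W i j • x j}

/-- A run of a black-box procedure using the matrix `W` on the local functions `f`, when a local
computation takes time `1` and a communication takes time `τ`. `mem i t` is the memory of node `i`
at time `t`, `out i t` its output at time `t`. There is no memory before time `0`, so nothing can be
computed before time `1` nor received before time `τ`. Memories need not be finite. -/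
structure IsBlackBoxRun {n : ℕ} (W : Matrix (Fin n) (Fin n) ℝ) (τ : ℝ)
    (f : Fin n → L2Seq → ℝ) (mem : Fin n → ℝ → Set L2Seq) (out : Fin n → ℝ → L2Seq) :
    Prop where
  mem_neg : ∀ i, ∀ t < 0, mem i t = ∅
  mem_zero : ∀ i, mem i 0 = {0}
  /-- Memories are updated by local computations or by communications. -/
  mem_step : ∀ i, ∀ t > 0, mem i t ⊆
    (compSpan (f i) (mem i (t - 1)) : Set L2Seq) ∪ commSpan W (fun j => mem j (t - τ)) i
  /-- The local output is a vector of the local memory. -/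
  out_mem : ∀ i, ∀ t ≥ 0, out i t ∈ mem i t

end

/-!
The nodes hold quadratic functions on `ℓ²` whose Hessians are built from two involutions of the
coordinates, and the network keeps the two groups of nodes that matter far apart.

*The functions.* The average objective is, up to a constant, `α / 2 * ‖x‖ ^ 2` plus `δ / 2` times the
squared differences of consecutive coordinates (and a term in `x 0`), minus a linear term in `x 0`.
With `δ = α q / (1 - q) ^ 2` its minimizer is the geometric sequence `q ^ i` (`swapGrad_geomSeq`).
A group `A` of nodes holds the linear term and couples the coordinates `2 j + 1` and `2 j + 2`, a group
`B` couples `2 j` and `2 j + 1`, all other nodes hold `α / 2 * ‖x‖ ^ 2`. The Hessians are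
`α + c (1 - R)` with a symmetric involution `R`, so the conjugates are quadratic of the same shape and
their gradients, like those of the functions, preserve the vectors supported below an odd index
(for `A`) or below an even index (for `B`); see `compSpan_localFun_le`.

*Propagation.* Hence the memories hold only vectors supported below some `k`, and `k` can grow only
alternately in `A` and in `B`. Each new coordinate costs one computation and, after the first, a trip
of `Δ` communications between the groups, so at time `t` at most `1 + t / (1 + Δ τ)` coordinates are
non-zero (`exists_supportedBelow_of_run`).

*The value.* A vector supported below `k` misses the tail of the minimizer. The tail alone accounts
for a factor `1 + q` over strong convexity; the cost of joining it to the first `k` coordinates is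
bounded by a Riccati-type recursion (`le_sum_globalForm`) and raises it to `(1 + q) ^ 2 ≥ 3`
(`le_globalForm`).

*The network.* On a path, the Poincaré inequality bounds the eigengap from below by the inverse
square of the length. Doubling every node adds a single new eigenvalue `s` that can be chosen freely
above the old ones, without shortening distances; taking `s` to be the second smallest eigenvalue
divided by `γ` makes the eigengap equal to `γ` (`exists_twinMatrix_eigengap`). The length of the path
is then chosen so that `A` and `B`, its two ends, hold at least a quarter of the nodes each and are
`Δ ≥ 1 / (5 √γ)` communications apart (`exists_network`).

The ratio is `q = 1 - 4 / √κ`, so that `q ^ 4 ≥ 1 - 16 / √κ`. If `1 - 16 / √κ ≤ 0`, the bound only says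
that the minimizer is one, and `q = 0` is used.
-/

open Matrix

/-! ### Eigenvalues of a gossip matrix -/

theorem Matrix.IsHermitian.exists_eigenvalues₀_eq_iff {n : ℕ} {W : Matrix (Fin n) (Fin n) ℝ}
    (hW : W.IsHermitian) (μ : ℝ) :
    (∃ k, hW.eigenvalues₀ k = μ) ↔ ∃ x : Fin n → ℝ, x ≠ 0 ∧ W *ᵥ x = μ • x := by
  have h1 : (∃ k, hW.eigenvalues₀ k = μ) ↔ ∃ i, hW.eigenvalues i = μ := by
    constructor
    · rintro ⟨k, hk⟩
      exact ⟨Fintype.equivOfCardEq (Fintype.card_fin _) k, by simp [IsHermitian.eigenvalues, hk]⟩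
    · rintro ⟨i, hi⟩
      exact ⟨_, hi⟩
  rw [h1]
  constructor
  · rintro ⟨i, rfl⟩
    refine ⟨hW.eigenvectorBasis i, fun h => ?_, hW.mulVec_eigenvectorBasis i⟩
    refine hW.eigenvectorBasis.orthonormal.ne_zero i ?_
    ext j
    exact congrFun h j
  · rintro ⟨x, hx0, hx⟩
    have h2 : Module.End.HasEigenvalue (Matrix.toLin' W) μ :=
      Module.End.hasEigenvalue_of_hasEigenvector (x := x)
        ⟨Module.End.mem_eigenspace_iff.2 (by simpa using hx), hx0⟩
    have h3 := h2.mem_spectrum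
    rw [Matrix.spectrum_toLin', hW.spectrum_real_eq_range_eigenvalues] at h3
    exact h3

/-- A one-dimensional kernel means that `0` occurs only once in the list of eigenvalues. -/
theorem Matrix.IsHermitian.eq_of_eigenvalues₀_eq_zero {n : ℕ} {W : Matrix (Fin n) (Fin n) ℝ}
    (hW : W.IsHermitian) (hker : ∀ x, W *ᵥ x = 0 → ∃ c : ℝ, x = fun _ => c)
    {k l : Fin (Fintype.card (Fin n))} (hk : hW.eigenvalues₀ k = 0)
    (hl : hW.eigenvalues₀ l = 0) : k = l := by
  by_contra hkl
  set e := Fintype.equivOfCardEq (Fintype.card_fin (Fintype.card (Fin n)))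
  have key : ∀ k, hW.eigenvalues₀ k = 0 →
      ∃ c : ℝ, c ≠ 0 ∧ ∀ j, hW.eigenvectorBasis (e k) j = c := by
    intro k hk
    have h1 := hW.mulVec_eigenvectorBasis (e k)
    have h2 : hW.eigenvalues (e k) = 0 := by simp [IsHermitian.eigenvalues, e, hk]
    rw [h2, zero_smul] at h1
    obtain ⟨c, hc⟩ := hker _ h1
    refine ⟨c, ?_, fun j => congrFun hc j⟩
    rintro rfl
    refine hW.eigenvectorBasis.orthonormal.ne_zero (e k) ?_
    ext j
    exact congrFun hc j
  obtain ⟨c, hc0, hc⟩ := key k hk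
  obtain ⟨d, hd0, hd⟩ := key l hl
  have horth : inner ℝ (hW.eigenvectorBasis (e k)) (hW.eigenvectorBasis (e l)) = 0 :=
    hW.eigenvectorBasis.orthonormal.2 (fun h => hkl (e.injective h))
  rw [PiLp.inner_apply] at horth
  simp only [hc, hd] at horth
  have : n ≠ 0 := by
    rintro rfl
    exact absurd k.2 (by simp)
  simp [hc0, hd0, this] at horth

/-- A symmetric matrix with kernel spanned by `1` whose non-zero eigenvalues have minimum `m > 0`
and maximum `L` is a gossip matrix on every graph that contains its support; its normalized
eigengap is `m / L`. -/
theorem isGossipMatrix_and_eigengap {n : ℕ} (hn : 2 ≤ n) {W : Matrix (Fin n) (Fin n) ℝ}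
    {G : SimpleGraph (Fin n)} (hW : W.IsHermitian) (hG : ∀ i j, W i j ≠ 0 → i = j ∨ G.Adj i j)
    (hone : W *ᵥ (fun _ => 1) = 0) (hker : ∀ x, W *ᵥ x = 0 → ∃ c : ℝ, x = fun _ => c)
    {m L : ℝ} (hm : 0 < m)
    (heig : ∀ (μ : ℝ) (x : Fin n → ℝ), x ≠ 0 → W *ᵥ x = μ • x → μ = 0 ∨ m ≤ μ ∧ μ ≤ L)
    (hmeig : ∃ x : Fin n → ℝ, x ≠ 0 ∧ W *ᵥ x = m • x)
    (hLeig : ∃ x : Fin n → ℝ, x ≠ 0 ∧ W *ᵥ x = L • x) :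
    ∃ h : IsGossipMatrix G W, eigengap hn h.isHermitian = m / L := by
  have heig' : ∀ k, hW.eigenvalues₀ k = 0 ∨ m ≤ hW.eigenvalues₀ k ∧ hW.eigenvalues₀ k ≤ L := by
    intro k
    obtain ⟨x, hx0, hx⟩ := (hW.exists_eigenvalues₀_eq_iff _).1 ⟨k, rfl⟩
    exact heig _ x hx0 hx
  have hnonneg : ∀ k, 0 ≤ hW.eigenvalues₀ k := fun k => by
    rcases heig' k with h | h <;> linarith
  have hmL : m ≤ L := by
    obtain ⟨x, hx0, hx⟩ := hmeig
    rcases heig m x hx0 hx with h | h <;> linarith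
  have hone0 : (fun _ => 1 : Fin n → ℝ) ≠ 0 := fun h => by
    simpa using congrFun h ⟨0, by omega⟩
  refine ⟨⟨hW, ?_, ?_, hG⟩, ?_⟩
  · exact hW.posSemidef_iff_eigenvalues_nonneg.2 fun i => hnonneg _
  · ext x
    rw [LinearMap.mem_ker, Matrix.toLin'_apply, Submodule.mem_span_singleton]
    constructor
    · intro h
      obtain ⟨c, rfl⟩ := hker x h
      exact ⟨c, by ext; simp⟩
    · rintro ⟨c, rfl⟩
      rw [Matrix.mulVec_smul, hone, smul_zero]
  · have hfirst : hW.eigenvalues₀ ⟨0, by simp only [Fintype.card_fin]; omega⟩ = L := by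
      obtain ⟨k, hk⟩ := (hW.exists_eigenvalues₀_eq_iff L).2 hLeig
      apply le_antisymm
      · rcases heig' ⟨0, by simp only [Fintype.card_fin]; omega⟩ with h | h <;> linarith
      · rw [← hk]
        exact hW.eigenvalues₀_antitone (Fin.mk_le_of_le_val (Nat.zero_le _))
    have hlast : hW.eigenvalues₀ ⟨n - 1, by simp only [Fintype.card_fin]; omega⟩ = 0 := by
      obtain ⟨k, hk⟩ := (hW.exists_eigenvalues₀_eq_iff 0).2 ⟨_, hone0, by simpa using hone⟩
      apply le_antisymm _ (hnonneg _)
      rw [← hk]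
      refine hW.eigenvalues₀_antitone (Fin.le_def.2 ?_)
      have := k.2
      simp only [Fintype.card_fin] at this
      simp only
      omega
    have hsecond : hW.eigenvalues₀ ⟨n - 2, by simp only [Fintype.card_fin]; omega⟩ = m := by
      obtain ⟨k, hk⟩ := (hW.exists_eigenvalues₀_eq_iff m).2 hmeig
      apply le_antisymm
      · rw [← hk]
        refine hW.eigenvalues₀_antitone (Fin.le_def.2 ?_)
        have hk1 : k.1 ≠ n - 1 := fun h => by
          have h2 : k = ⟨n - 1, by simp only [Fintype.card_fin]; omega⟩ := Fin.ext h
          rw [h2, hlast] at hk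
          exact hm.ne hk
        have := k.2
        simp only [Fintype.card_fin] at this
        simp only
        omega
      · rcases heig' ⟨n - 2, by simp only [Fintype.card_fin]; omega⟩ with h | h
        · have := hW.eq_of_eigenvalues₀_eq_zero hker h hlast
          simp only [Fin.mk.injEq] at this
          omega
        · exact h.1
    unfold eigengap
    rw [hfirst, hsecond]

/-- The communication graph of a symmetric matrix whose kernel is spanned by `1` is connected:
the indicator of a connected component lies in the kernel. -/
theorem connected_of_ker {n : ℕ} (hn : 0 < n) {W : Matrix (Fin n) (Fin n) ℝ}
    {G : SimpleGraph (Fin n)} (hG : ∀ i j, W i j ≠ 0 → i = j ∨ G.Adj i j)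
    (hone : W *ᵥ (fun _ => 1) = 0) (hker : ∀ x, W *ᵥ x = 0 → ∃ c : ℝ, x = fun _ => c) :
    G.Connected := by
  classical
  have : Nonempty (Fin n) := ⟨⟨0, hn⟩⟩
  refine ⟨fun u v => ?_⟩
  let x : Fin n → ℝ := fun j => if G.Reachable u j then 1 else 0
  have hx : W *ᵥ x = 0 := by
    ext i
    by_cases hi : G.Reachable u i
    · rw [← hone]
      simp only [Matrix.mulVec, dotProduct]
      refine Finset.sum_congr rfl fun j _ => ?_
      by_cases hj : W i j = 0
      · simp [hj]
      · have : G.Reachable u j := by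
          rcases hG i j hj with h | h
          · exact h ▸ hi
          · exact hi.trans h.reachable
        simp [x, this]
    · simp only [Matrix.mulVec, dotProduct, Pi.zero_apply]
      refine Finset.sum_eq_zero fun j _ => ?_
      by_cases hj : W i j = 0
      · simp [hj]
      · have : ¬ G.Reachable u j := fun h' => by
          rcases hG i j hj with h | h
          · exact hi (h ▸ h')
          · exact hi (h'.trans h.symm.reachable)
        simp [x, this]
  obtain ⟨c, hc⟩ := hker x hx
  have h1 : x u = c := congrFun hc u
  have h2 : x v = c := congrFun hc v
  by_contra hv
  simp only [x, hv, SimpleGraph.Reachable.refl, if_true, if_false] at h1 h2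
  linarith

/-! ### Doubling a network -/

/-- Each node `i` of a network with matrix `W₀` is replaced by two twins `i` and `N + i`. On vectors
that agree on twins the new matrix acts as `W₀`, on vectors that are opposite on twins it acts as
the scalar `s`. -/
noncomputable def twinMatrix {N : ℕ} (W₀ : Matrix (Fin N) (Fin N) ℝ) (s : ℝ) :
    Matrix (Fin (N + N)) (Fin (N + N)) ℝ :=
  reindex finSumFinEquiv finSumFinEquiv
    (fromBlocks ((1 / 2 : ℝ) • (W₀ + s • 1)) ((1 / 2 : ℝ) • (W₀ - s • 1))
      ((1 / 2 : ℝ) • (W₀ - s • 1)) ((1 / 2 : ℝ) • (W₀ + s • 1)))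

/-- The original node of which a node of the doubled network is a copy. -/
def twinBase {N : ℕ} (i : Fin (N + N)) : Fin N :=
  Fin.addCases (motive := fun _ => Fin N) id id i

@[simp] theorem twinBase_castAdd {N : ℕ} (i : Fin N) : twinBase (Fin.castAdd N i) = i := by
  simp [twinBase]

@[simp] theorem twinBase_natAdd {N : ℕ} (i : Fin N) : twinBase (Fin.natAdd N i) = i :=
  Fin.addCases_right i

theorem twinMatrix_isHermitian {N : ℕ} {W₀ : Matrix (Fin N) (Fin N) ℝ} (h : W₀.IsHermitian)
    (s : ℝ) : (twinMatrix W₀ s).IsHermitian := by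
  have h' : W₀ᵀ = W₀ := by simpa [IsHermitian, conjTranspose_eq_transpose_of_trivial] using h
  rw [IsHermitian, conjTranspose_eq_transpose_of_trivial, twinMatrix, transpose_reindex,
    fromBlocks_transpose]
  simp [h']

theorem twinMatrix_mulVec_castAdd {N : ℕ} (W₀ : Matrix (Fin N) (Fin N) ℝ) (s : ℝ)
    (x : Fin (N + N) → ℝ) (i : Fin N) :
    (twinMatrix W₀ s *ᵥ x) (Fin.castAdd N i) =
      1 / 2 * ((W₀ *ᵥ fun j => x (Fin.castAdd N j) + x (Fin.natAdd N j)) i +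
        s * (x (Fin.castAdd N i) - x (Fin.natAdd N i))) := by
  have h : ∀ y : Fin N → ℝ, s * y i = ∑ j, s * (1 : Matrix (Fin N) (Fin N) ℝ) i j * y j := by
    intro y
    simp [Matrix.one_apply]
  rw [mul_sub, h (fun i => x (Fin.castAdd N i)), h (fun i => x (Fin.natAdd N i))]
  simp only [mulVec, dotProduct, Fin.sum_univ_add, twinMatrix, reindex_apply, submatrix_apply,
    finSumFinEquiv_symm_apply_castAdd, finSumFinEquiv_symm_apply_natAdd, fromBlocks_apply₁₁,
    fromBlocks_apply₁₂, Matrix.smul_apply, Matrix.add_apply, Matrix.sub_apply, smul_eq_mul]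
  rw [← Finset.sum_sub_distrib, ← Finset.sum_add_distrib, ← Finset.sum_add_distrib, Finset.mul_sum]
  exact Finset.sum_congr rfl fun j _ => by ring

theorem twinMatrix_mulVec_natAdd {N : ℕ} (W₀ : Matrix (Fin N) (Fin N) ℝ) (s : ℝ)
    (x : Fin (N + N) → ℝ) (i : Fin N) :
    (twinMatrix W₀ s *ᵥ x) (Fin.natAdd N i) =
      1 / 2 * ((W₀ *ᵥ fun j => x (Fin.castAdd N j) + x (Fin.natAdd N j)) i -
        s * (x (Fin.castAdd N i) - x (Fin.natAdd N i))) := by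
  have h : ∀ y : Fin N → ℝ, s * y i = ∑ j, s * (1 : Matrix (Fin N) (Fin N) ℝ) i j * y j := by
    intro y
    simp [Matrix.one_apply]
  rw [mul_sub s, h (fun i => x (Fin.castAdd N i)), h (fun i => x (Fin.natAdd N i))]
  simp only [mulVec, dotProduct, Fin.sum_univ_add, twinMatrix, reindex_apply, submatrix_apply,
    finSumFinEquiv_symm_apply_castAdd, finSumFinEquiv_symm_apply_natAdd, fromBlocks_apply₂₁,
    fromBlocks_apply₂₂, Matrix.smul_apply, Matrix.add_apply, Matrix.sub_apply, smul_eq_mul]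
  rw [← Finset.sum_sub_distrib, ← Finset.sum_sub_distrib, ← Finset.sum_add_distrib, Finset.mul_sum]
  exact Finset.sum_congr rfl fun j _ => by ring

theorem twinMatrix_apply_ne_zero {N : ℕ} {W₀ : Matrix (Fin N) (Fin N) ℝ} {s : ℝ}
    {i j : Fin (N + N)} (h : twinMatrix W₀ s i j ≠ 0) :
    twinBase i = twinBase j ∨ W₀ (twinBase i) (twinBase j) ≠ 0 := by
  contrapose! h
  obtain ⟨h1, h2⟩ := h
  revert h1 h2
  refine Fin.addCases (fun i => ?_) (fun i => ?_) i <;>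
  refine Fin.addCases (fun j => ?_) (fun j => ?_) j <;>
  · simp only [twinBase_castAdd, twinBase_natAdd]
    intro h1 h2
    simp [-Fin.natAdd_eq_addNat, twinMatrix, h1, h2]

/-- Eigenvectors for a non-zero eigenvalue are orthogonal to the kernel vector `1`. -/
theorem Matrix.IsHermitian.sum_eq_zero_of_mulVec_eq_smul {N : ℕ} {W₀ : Matrix (Fin N) (Fin N) ℝ}
    (h : W₀.IsHermitian) (hone : W₀ *ᵥ (fun _ => 1) = 0) {μ : ℝ} (hμ : μ ≠ 0) {x : Fin N → ℝ}
    (hx : W₀ *ᵥ x = μ • x) : ∑ i, x i = 0 := by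
  have h' : W₀ᵀ = W₀ := by simpa [IsHermitian, conjTranspose_eq_transpose_of_trivial] using h
  have h1 : (fun _ => 1 : Fin N → ℝ) ⬝ᵥ W₀ *ᵥ x = 0 := by
    rw [dotProduct_mulVec, ← mulVec_transpose, h', hone, zero_dotProduct]
  rw [hx, dotProduct_smul, smul_eq_mul] at h1
  simpa [dotProduct, hμ] using h1

/-- Every normalized eigengap `γ` below that of `W₀` is attained exactly by the doubled network: the
scalar `s` becomes the largest eigenvalue, and the smallest non-zero one is that of `W₀`. -/
theorem exists_twinMatrix_eigengap {N : ℕ} (hN : 2 ≤ N) {W₀ : Matrix (Fin N) (Fin N) ℝ}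
    (hW₀ : W₀.IsHermitian) (hone : W₀ *ᵥ (fun _ => 1) = 0) {γ L : ℝ} (hγ0 : 0 < γ) (hγ1 : γ ≤ 1)
    (hL : 0 < L)
    (hlow : ∀ x : Fin N → ℝ, ∑ i, x i = 0 → γ * L * (x ⬝ᵥ x) ≤ x ⬝ᵥ W₀ *ᵥ x)
    (hup : ∀ x : Fin N → ℝ, x ⬝ᵥ W₀ *ᵥ x ≤ L * (x ⬝ᵥ x)) :
    ∃ (s : ℝ) (G : SimpleGraph (Fin (N + N))) (h : IsGossipMatrix G (twinMatrix W₀ s)),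
      G.Connected ∧ eigengap (by omega : 2 ≤ N + N) h.isHermitian = γ := by
  classical
  have hpos : ∀ x : Fin N → ℝ, x ≠ 0 → 0 < x ⬝ᵥ x := fun x hx => by
    simpa using dotProduct_star_self_pos_iff.2 hx
  -- the non-zero eigenvalues of `W₀` lie in `[γ L, L]`
  have heig : ∀ (μ : ℝ) (x : Fin N → ℝ), x ≠ 0 → W₀ *ᵥ x = μ • x → μ = 0 ∨ γ * L ≤ μ ∧ μ ≤ L := by
    intro μ x hx0 hx
    by_cases hμ : μ = 0
    · exact Or.inl hμ
    have h1 := hlow x (hW₀.sum_eq_zero_of_mulVec_eq_smul hone hμ hx)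
    have h2 := hup x
    rw [hx, dotProduct_smul, smul_eq_mul] at h1 h2
    exact Or.inr ⟨le_of_mul_le_mul_right h1 (hpos x hx0), le_of_mul_le_mul_right h2 (hpos x hx0)⟩
  have hker : ∀ x, W₀ *ᵥ x = 0 → ∃ c : ℝ, x = fun _ => c := by
    intro x hx
    set c : ℝ := (∑ i, x i) / N
    have hN0 : (N : ℝ) ≠ 0 := by positivity
    set y : Fin N → ℝ := x - c • (fun _ => 1)
    have hy : W₀ *ᵥ y = 0 := by rw [mulVec_sub, mulVec_smul, hone, hx]; simp
    have hy0 : ∑ i, y i = 0 := by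
      simp [y, c]
      field_simp
      simp
    have h1 := hlow y hy0
    rw [hy, dotProduct_zero] at h1
    refine ⟨c, ?_⟩
    by_contra hne
    have h2 : y ≠ 0 := fun h => hne (by
      ext i
      have := congrFun h i
      simp only [y, Pi.sub_apply, Pi.smul_apply, smul_eq_mul, mul_one, Pi.zero_apply] at this
      linarith)
    have := mul_pos (mul_pos hγ0 hL) (hpos y h2)
    linarith
  -- the least non-zero eigenvalue of `W₀`
  obtain ⟨m, hm0, ⟨u, hu0, hu⟩, hmin⟩ : ∃ m : ℝ, m ≠ 0 ∧
      (∃ x : Fin N → ℝ, x ≠ 0 ∧ W₀ *ᵥ x = m • x) ∧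
      ∀ (μ : ℝ) (x : Fin N → ℝ), x ≠ 0 → W₀ *ᵥ x = μ • x → μ ≠ 0 → m ≤ μ := by
    have hne : (Finset.univ.filter fun k => hW₀.eigenvalues₀ k ≠ 0).Nonempty := by
      by_contra hempty
      rw [Finset.not_nonempty_iff_eq_empty, Finset.filter_eq_empty_iff] at hempty
      have hzero : W₀ = 0 := hW₀.eigenvalues_eq_zero_iff.1 (by
        ext i
        exact not_not.1 (hempty (Finset.mem_univ _)))
      obtain ⟨c, hc⟩ := hker (Pi.single ⟨0, by omega⟩ 1) (by rw [hzero, zero_mulVec])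
      have h0 := congrFun hc ⟨0, by omega⟩
      have h1 := congrFun hc ⟨1, by omega⟩
      simp at h0 h1
      rw [← h0] at h1
      simp at h1
    obtain ⟨k, hk, hkmin⟩ := Finset.exists_min_image _ hW₀.eigenvalues₀ hne
    refine ⟨hW₀.eigenvalues₀ k, (Finset.mem_filter.1 hk).2,
      (hW₀.exists_eigenvalues₀_eq_iff _).1 ⟨k, rfl⟩, ?_⟩
    intro μ x hx0 hx hμ
    obtain ⟨l, rfl⟩ := (hW₀.exists_eigenvalues₀_eq_iff μ).2 ⟨x, hx0, hx⟩
    exact hkmin l (by simpa using hμ)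
  have hγLm : γ * L ≤ m := ((heig m u hu0 hu).resolve_left hm0).1
  have hm : 0 < m := (mul_pos hγ0 hL).trans_le hγLm
  set s : ℝ := m / γ with hs
  have hms : m ≤ s := by rw [hs, le_div_iff₀ hγ0]; nlinarith
  have hLs : L ≤ s := by rw [hs, le_div_iff₀ hγ0]; linarith
  set W := twinMatrix W₀ s
  -- sums and differences over twins separate the two parts of an eigenvector
  have hsum : ∀ (μ : ℝ) (x : Fin (N + N) → ℝ), W *ᵥ x = μ • x →
      W₀ *ᵥ (fun j => x (Fin.castAdd N j) + x (Fin.natAdd N j)) =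
        μ • fun j => x (Fin.castAdd N j) + x (Fin.natAdd N j) := by
    intro μ x hx
    ext i
    have h1 := congrFun hx (Fin.castAdd N i)
    have h2 := congrFun hx (Fin.natAdd N i)
    rw [twinMatrix_mulVec_castAdd] at h1
    rw [twinMatrix_mulVec_natAdd] at h2
    simp only [Pi.smul_apply, smul_eq_mul] at h1 h2 ⊢
    linarith
  have hdiff : ∀ (μ : ℝ) (x : Fin (N + N) → ℝ), W *ᵥ x = μ • x → ∀ i,
      (s - μ) * (x (Fin.castAdd N i) - x (Fin.natAdd N i)) = 0 := by
    intro μ x hx i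
    have h1 := congrFun hx (Fin.castAdd N i)
    have h2 := congrFun hx (Fin.natAdd N i)
    rw [twinMatrix_mulVec_castAdd] at h1
    rw [twinMatrix_mulVec_natAdd] at h2
    simp only [Pi.smul_apply, smul_eq_mul] at h1 h2 ⊢
    linarith
  have hWone : W *ᵥ (fun _ => 1) = 0 := by
    have h2 : W₀ *ᵥ (fun _ => (1 : ℝ) + 1) = 0 := by
      have : (fun _ => (1 : ℝ) + 1 : Fin N → ℝ) = (2 : ℝ) • fun _ => 1 := by ext; norm_num
      rw [this, mulVec_smul, hone, smul_zero]
    ext i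
    refine Fin.addCases (fun i => ?_) (fun i => ?_) i
    · rw [twinMatrix_mulVec_castAdd, h2]; simp
    · rw [twinMatrix_mulVec_natAdd, h2]; simp
  have hWker : ∀ x, W *ᵥ x = 0 → ∃ c : ℝ, x = fun _ => c := by
    intro x hx
    have hx' : W *ᵥ x = (0 : ℝ) • x := by rw [hx, zero_smul]
    obtain ⟨c, hc⟩ := hker _ ((hsum 0 x hx').trans (zero_smul _ _))
    refine ⟨c / 2, ?_⟩
    have h1 : ∀ i, x (Fin.castAdd N i) - x (Fin.natAdd N i) = 0 := fun i => by
      have := hdiff 0 x hx' i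
      rw [sub_zero] at this
      exact (mul_eq_zero.1 this).resolve_left (hm.trans_le hms).ne'
    ext i
    refine Fin.addCases (fun i => ?_) (fun i => ?_) i
    · have h2 := congrFun hc i
      have h3 := h1 i
      linarith
    · have h2 := congrFun hc i
      have h3 := h1 i
      linarith
  let G : SimpleGraph (Fin (N + N)) := SimpleGraph.fromRel fun i j => W i j ≠ 0
  have hG : ∀ i j, W i j ≠ 0 → i = j ∨ G.Adj i j := by
    intro i j hij
    by_cases h : i = j
    · exact Or.inl h
    · exact Or.inr ((SimpleGraph.fromRel_adj _ _ _).2 ⟨h, Or.inl hij⟩)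
  obtain ⟨h, hgap⟩ := isGossipMatrix_and_eigengap (by omega : 2 ≤ N + N)
    (twinMatrix_isHermitian hW₀ s) hG hWone hWker (m := m) (L := s) hm
    (by
      intro μ x hx0 hx
      by_cases hμ : s = μ
      · exact Or.inr ⟨hμ ▸ hms, hμ.ge⟩
      have h1 : ∀ i, x (Fin.castAdd N i) - x (Fin.natAdd N i) = 0 := fun i =>
        (mul_eq_zero.1 (hdiff μ x hx i)).resolve_left (sub_ne_zero.2 hμ)
      have hne : (fun j => x (Fin.castAdd N j) + x (Fin.natAdd N j)) ≠ 0 := by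
        intro h0
        refine hx0 (funext fun i => ?_)
        refine Fin.addCases (fun i => ?_) (fun i => ?_) i
        · have h2 := congrFun h0 i; have h3 := h1 i; simp only [Pi.zero_apply] at h2 ⊢; linarith
        · have h2 := congrFun h0 i; have h3 := h1 i; simp only [Pi.zero_apply] at h2 ⊢; linarith
      rcases heig μ _ hne (hsum μ x hx) with h | h
      · exact Or.inl h
      by_cases hμ0 : μ = 0
      · exact Or.inl hμ0
      · exact Or.inr ⟨hmin μ _ hne (hsum μ x hx) hμ0, h.2.trans hLs⟩)
    (by
      refine ⟨fun i => u (twinBase i), fun h => hu0 (funext fun i => ?_), ?_⟩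
      · simpa using congrFun h (Fin.castAdd N i)
      · have h2 : (W₀ *ᵥ fun j => u j + u j) = m • fun j => u j + u j := by
          have : (fun j => u j + u j) = (2 : ℝ) • u := by ext; simp; ring
          rw [this, mulVec_smul, hu, smul_comm]
        ext i
        refine Fin.addCases (fun i => ?_) (fun i => ?_) i
        · rw [twinMatrix_mulVec_castAdd]; simp [-Fin.natAdd_eq_addNat, h2]; ring
        · rw [twinMatrix_mulVec_natAdd]; simp [-Fin.natAdd_eq_addNat, h2]; ring)
    (by
      refine ⟨fun i => Fin.addCases (motive := fun _ => ℝ) (fun _ => 1) (fun _ => -1) i,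
        fun h => ?_, ?_⟩
      · simpa using congrFun h (Fin.castAdd N ⟨0, by omega⟩)
      · have h2 : (W₀ *ᵥ fun _ => (0 : ℝ)) = 0 := mulVec_zero _
        ext i
        refine Fin.addCases (fun i => ?_) (fun i => ?_) i
        · rw [twinMatrix_mulVec_castAdd]; simp [-Fin.natAdd_eq_addNat, h2]; ring
        · rw [twinMatrix_mulVec_natAdd]; simp [-Fin.natAdd_eq_addNat, h2]; ring)
  refine ⟨s, G, h, connected_of_ker (by omega) hG hWone hWker, ?_⟩
  rw [hgap, hs]
  field_simp

/-! ### The path -/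

/-- The oriented incidence matrix of the path with `M` edges. -/
noncomputable def pathIncidence (M : ℕ) : Matrix (Fin M) (Fin (M + 1)) ℝ :=
  (1 : Matrix (Fin (M + 1)) (Fin (M + 1)) ℝ).submatrix Fin.succ id -
    (1 : Matrix (Fin (M + 1)) (Fin (M + 1)) ℝ).submatrix Fin.castSucc id

/-- The Laplacian matrix of the path with `M` edges. -/
noncomputable def pathLaplacian (M : ℕ) : Matrix (Fin (M + 1)) (Fin (M + 1)) ℝ :=
  (pathIncidence M)ᵀ * pathIncidence M

theorem pathIncidence_mulVec (M : ℕ) (x : Fin (M + 1) → ℝ) (e : Fin M) :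
    (pathIncidence M *ᵥ x) e = x e.succ - x e.castSucc := by
  simp [pathIncidence, mulVec, dotProduct, Matrix.one_apply, sub_mul, Finset.sum_sub_distrib]

theorem pathLaplacian_isHermitian (M : ℕ) : (pathLaplacian M).IsHermitian := by
  simp [IsHermitian, conjTranspose_eq_transpose_of_trivial, pathLaplacian, transpose_mul]

theorem pathLaplacian_mulVec_one (M : ℕ) : pathLaplacian M *ᵥ (fun _ => 1) = 0 := by
  have : pathIncidence M *ᵥ (fun _ => 1) = 0 := by
    ext e
    simp [pathIncidence_mulVec]
  rw [pathLaplacian, ← mulVec_mulVec, this, mulVec_zero]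

theorem dotProduct_pathLaplacian_mulVec (M : ℕ) (x : Fin (M + 1) → ℝ) :
    x ⬝ᵥ pathLaplacian M *ᵥ x = ∑ e : Fin M, (x e.succ - x e.castSucc) ^ 2 := by
  rw [pathLaplacian, ← mulVec_mulVec, dotProduct_mulVec, vecMul_transpose, dotProduct]
  simp [pathIncidence_mulVec, sq]

theorem pathLaplacian_apply_ne_zero {M : ℕ} {i j : Fin (M + 1)} (h : pathLaplacian M i j ≠ 0) :
    (i : ℕ) ≤ j + 1 ∧ (j : ℕ) ≤ i + 1 := by
  rw [pathLaplacian, mul_apply] at h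
  obtain ⟨e, -, he⟩ := Finset.exists_ne_zero_of_sum_ne_zero h
  have key : ∀ i, pathIncidence M e i ≠ 0 → (e : ℕ) ≤ i ∧ (i : ℕ) ≤ e + 1 := by
    intro i hi
    by_contra hcon
    apply hi
    have h1 : e.succ ≠ i := fun h => hcon (by rw [← h]; simp)
    have h2 : e.castSucc ≠ i := fun h => hcon (by rw [← h]; simp)
    simp [pathIncidence, h1, h2]
  have h1 := key i (left_ne_zero_of_mul he)
  have h2 := key j (right_ne_zero_of_mul he)
  omega

theorem dotProduct_pathLaplacian_mulVec_le (M : ℕ) (x : Fin (M + 1) → ℝ) :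
    x ⬝ᵥ pathLaplacian M *ᵥ x ≤ 4 * (x ⬝ᵥ x) := by
  have h1 : x ⬝ᵥ x = x 0 ^ 2 + ∑ e : Fin M, x e.succ ^ 2 := by
    simp [dotProduct, Fin.sum_univ_succ, sq]
  have h2 : x ⬝ᵥ x = ∑ e : Fin M, x e.castSucc ^ 2 + x (Fin.last M) ^ 2 := by
    simp [dotProduct, Fin.sum_univ_castSucc, sq]
  have h3 : x ⬝ᵥ pathLaplacian M *ᵥ x ≤
      2 * (∑ e : Fin M, x e.succ ^ 2) + 2 * ∑ e : Fin M, x e.castSucc ^ 2 := by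
    rw [dotProduct_pathLaplacian_mulVec, Finset.mul_sum, Finset.mul_sum, ← Finset.sum_add_distrib]
    exact Finset.sum_le_sum fun e _ => by nlinarith [sq_nonneg (x e.succ + x e.castSucc)]
  nlinarith [sq_nonneg (x 0), sq_nonneg (x (Fin.last M))]

/-- The Poincaré inequality on a path. -/
theorem dotProduct_le_pathLaplacian (M : ℕ) (x : Fin (M + 1) → ℝ) (hx : ∑ i, x i = 0) :
    x ⬝ᵥ x ≤ (M + 1) ^ 2 / 2 * (x ⬝ᵥ pathLaplacian M *ᵥ x) := by
  rw [dotProduct_pathLaplacian_mulVec]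
  set E : ℝ := ∑ e : Fin M, (x e.succ - x e.castSucc) ^ 2
  have hE : 0 ≤ E := Finset.sum_nonneg fun e _ => sq_nonneg _
  have htel : ∀ i : Fin (M + 1), x i - x 0 =
      ∑ e : Fin M, (if (e : ℕ) < i then 1 else 0) * (x e.succ - x e.castSucc) := by
    intro i
    induction i using Fin.induction with
    | zero => simp
    | succ i ih =>
      have h : ∀ e : Fin M, (if (e : ℕ) < i.succ then (1 : ℝ) else 0) =
          (if (e : ℕ) < i.castSucc then 1 else 0) + if e = i then 1 else 0 := by
        intro e
        have : e = i ↔ (e : ℕ) = i := Fin.ext_iff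
        by_cases h1 : (e : ℕ) < i
        · have h2 : (e : ℕ) < i + 1 := by omega
          have h3 : e ≠ i := fun h => by rw [h] at h1; omega
          simp [h1, h2, h3]
        · by_cases h3 : e = i
          · simp [h3]
          · have h2 : ¬ (e : ℕ) < i + 1 := by omega
            simp [h1, h2, h3]
      simp only [h, add_mul, Finset.sum_add_distrib, ← ih]
      simp
  have hsq : ∀ i : Fin (M + 1), (x i - x 0) ^ 2 ≤ i * E := by
    intro i
    rw [htel i]
    refine (Finset.sum_mul_sq_le_sq_mul_sq _ _ _).trans ?_
    refine mul_le_mul_of_nonneg_right ?_ hE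
    have : ∑ e : Fin M, (if (e : ℕ) < i then (1 : ℝ) else 0) ^ 2 =
        ((Finset.univ.filter fun e : Fin M => (e : ℕ) < i).card : ℝ) := by
      simp [ite_pow]
    rw [this]
    norm_cast
    calc (Finset.univ.filter fun e : Fin M => (e : ℕ) < i).card
        ≤ (Finset.range i).card :=
          Finset.card_le_card_of_injOn (fun e => (e : ℕ)) (fun e he => by simpa using he)
            (fun a _ b _ h => Fin.ext h)
      _ = i := Finset.card_range _
  have hsum : ∑ i : Fin (M + 1), ((i : ℕ) : ℝ) ≤ (M + 1) ^ 2 / 2 := by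
    rw [Fin.sum_univ_eq_sum_range (fun i => (i : ℝ)) (M + 1)]
    have := Finset.sum_range_id_mul_two (M + 1)
    have h2 : ((∑ i ∈ Finset.range (M + 1), i : ℕ) : ℝ) * 2 = (M + 1) * M := by
      exact_mod_cast this
    push_cast at h2
    nlinarith [(Nat.cast_nonneg M : (0 : ℝ) ≤ M)]
  calc x ⬝ᵥ x ≤ ∑ i, (x i - x 0) ^ 2 := by
        have : ∑ i, (x i - x 0) ^ 2 = x ⬝ᵥ x - 2 * x 0 * ∑ i, x i + (M + 1) * x 0 ^ 2 := by
          rw [dotProduct, Finset.mul_sum, ← Finset.sum_sub_distrib]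
          have : ((M : ℝ) + 1) * x 0 ^ 2 = ∑ _i : Fin (M + 1), x 0 ^ 2 := by simp
          rw [this, ← Finset.sum_add_distrib]
          exact Finset.sum_congr rfl fun i _ => by ring
        rw [this, hx]
        have : 0 ≤ ((M : ℝ) + 1) * x 0 ^ 2 := by positivity
        linarith
    _ ≤ ∑ i : Fin (M + 1), ((i : ℕ) : ℝ) * E := Finset.sum_le_sum fun i _ => hsq i
    _ = (∑ i : Fin (M + 1), ((i : ℕ) : ℝ)) * E := by rw [Finset.sum_mul]
    _ ≤ _ := mul_le_mul_of_nonneg_right hsum hE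

/-! ### A network with a given eigengap and two distant groups of nodes -/

theorem card_filter_twinBase {N : ℕ} (p : Fin N → Prop) [DecidablePred p] :
    (Finset.univ.filter fun i : Fin (N + N) => p (twinBase i)).card =
      2 * (Finset.univ.filter p).card := by
  rw [Finset.card_filter, Finset.card_filter, Fin.sum_univ_add]
  simp only [twinBase_castAdd, twinBase_natAdd]
  ring

/-- In a doubled path, the twins of the first `a` nodes and those of the last `a` nodes are `Δ`
communications apart. -/
theorem exists_network_of_path {γ L : ℝ} (hγ0 : 0 < γ) (hγ1 : γ ≤ 1) (hL : 0 < L) {M a Δ : ℕ}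
    (ha : 1 ≤ a) (hΔ : 1 ≤ Δ) (hM : M + 2 = 2 * a + Δ) (hMa : M + 1 ≤ 4 * a)
    (hlow : ∀ x : Fin (M + 1) → ℝ, ∑ i, x i = 0 → γ * L * (x ⬝ᵥ x) ≤ x ⬝ᵥ pathLaplacian M *ᵥ x)
    (hup : ∀ x : Fin (M + 1) → ℝ, x ⬝ᵥ pathLaplacian M *ᵥ x ≤ L * (x ⬝ᵥ x)) :
    ∃ (n : ℕ) (hn : 2 ≤ n) (G : SimpleGraph (Fin n)) (W : Matrix (Fin n) (Fin n) ℝ)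
      (hW : IsGossipMatrix G W) (A B : Finset (Fin n)) (d : Fin n → ℕ),
      G.Connected ∧ eigengap hn hW.isHermitian = γ ∧ n ≤ 4 * A.card ∧ n ≤ 4 * B.card ∧
      (∀ i ∈ A, d i = 0) ∧ (∀ i ∈ B, Δ ≤ d i) ∧
      ∀ i j, W i j ≠ 0 → d i ≤ d j + 1 ∧ d j ≤ d i + 1 := by
  obtain ⟨s, G, h, hG, hgap⟩ := exists_twinMatrix_eigengap (by omega)
    (pathLaplacian_isHermitian M) (pathLaplacian_mulVec_one M) hγ0 hγ1 hL hlow hup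
  refine ⟨M + 1 + (M + 1), by omega, G, _, h,
    Finset.univ.filter fun i => (twinBase i : ℕ) < a,
    Finset.univ.filter fun i => a - 1 + Δ ≤ (twinBase i : ℕ),
    fun i => (twinBase i : ℕ) - (a - 1), hG, hgap, ?_, ?_, ?_, ?_, ?_⟩
  · rw [card_filter_twinBase (fun i : Fin (M + 1) => (i : ℕ) < a)]
    have : a ≤ (Finset.univ.filter fun i : Fin (M + 1) => (i : ℕ) < a).card := by
      have := Finset.card_le_card_of_injOn (s := (Finset.univ : Finset (Fin a)))
        (t := Finset.univ.filter fun i : Fin (M + 1) => (i : ℕ) < a)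
        (fun i => ⟨i, by omega⟩) (fun i _ => by simp)
        (fun i _ j _ hij => Fin.ext (by simpa using hij))
      simpa using this
    omega
  · rw [card_filter_twinBase (fun i : Fin (M + 1) => a - 1 + Δ ≤ (i : ℕ))]
    have : a ≤ (Finset.univ.filter fun i : Fin (M + 1) => a - 1 + Δ ≤ (i : ℕ)).card := by
      have := Finset.card_le_card_of_injOn (s := (Finset.univ : Finset (Fin a)))
        (t := Finset.univ.filter fun i : Fin (M + 1) => a - 1 + Δ ≤ (i : ℕ))
        (fun i => ⟨a - 1 + Δ + i, by omega⟩) (fun i _ => by simp)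
        (fun i _ j _ hij => Fin.ext (by simpa using hij))
      simpa using this
    omega
  · intro i hi
    simp only [Finset.mem_filter, Finset.mem_univ, true_and] at hi ⊢
    omega
  · intro i hi
    simp only [Finset.mem_filter, Finset.mem_univ, true_and] at hi ⊢
    omega
  · intro i j hij
    beta_reduce
    rcases twinMatrix_apply_ne_zero hij with h | h
    · rw [h]
      omega
    · have := pathLaplacian_apply_ne_zero h
      omega

/-- For every `γ ∈ (0, 1]` there is a gossip matrix with eigengap `γ` in which two groups, each with
at least a quarter of the nodes, are at least `1 / (5 √γ)` communications apart; `d` is the number of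
communications needed to leave the first group. -/
theorem exists_network {γ : ℝ} (hγ0 : 0 < γ) (hγ1 : γ ≤ 1) :
    ∃ (n : ℕ) (hn : 2 ≤ n) (G : SimpleGraph (Fin n)) (W : Matrix (Fin n) (Fin n) ℝ)
      (hW : IsGossipMatrix G W) (A B : Finset (Fin n)) (d : Fin n → ℕ) (Δ : ℕ),
      G.Connected ∧ eigengap hn hW.isHermitian = γ ∧ 1 ≤ Δ ∧ 1 / (5 * √γ) ≤ Δ ∧
      n ≤ 4 * A.card ∧ n ≤ 4 * B.card ∧ (∀ i ∈ A, d i = 0) ∧ (∀ i ∈ B, Δ ≤ d i) ∧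
      ∀ i j, W i j ≠ 0 → d i ≤ d j + 1 ∧ d j ≤ d i + 1 := by
  have hs : 0 < √γ := Real.sqrt_pos.2 hγ0
  have hss : √γ * √γ = γ := Real.mul_self_sqrt hγ0.le
  by_cases hγ : 1 ≤ 5 * √γ
  · -- a single edge, whose two Laplacian eigenvalues are `0` and `2`
    have key : ∀ x : Fin (1 + 1) → ℝ, x ⬝ᵥ pathLaplacian 1 *ᵥ x = (x 1 - x 0) ^ 2 := fun x => by
      rw [dotProduct_pathLaplacian_mulVec]
      simp
    have key2 : ∀ x : Fin (1 + 1) → ℝ, x ⬝ᵥ x = x 0 * x 0 + x 1 * x 1 := fun x =>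
      Fin.sum_univ_two _
    obtain ⟨n, hn, G, W, hW, A, B, d, h1, h2, h3, h4, h5, h6, h7⟩ :=
      exists_network_of_path hγ0 hγ1 (L := 2) (by norm_num) (M := 1) (a := 1) (Δ := 1)
      le_rfl le_rfl rfl (by norm_num)
      (fun x hx => by
        have hx' : x 0 + x 1 = 0 := (Fin.sum_univ_two x).symm.trans hx
        have : x 1 = - x 0 := by linarith
        rw [key, key2, this]
        nlinarith [sq_nonneg (x 0)])
      (fun x => by
        rw [key, key2]
        nlinarith [sq_nonneg (x 0 + x 1)])
    refine ⟨n, hn, G, W, hW, A, B, d, 1, h1, h2, le_rfl, ?_, h3, h4, h5, h6, h7⟩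
    rw [div_le_iff₀ (by positivity)]
    simpa using hγ
  · push Not at hγ
    -- a path with `3 D` nodes, where `D < 1 / (5 √γ) ≤ D + 1`
    obtain ⟨D, hD1, hDlt, hDle⟩ : ∃ D : ℕ, 1 ≤ D ∧ (D : ℝ) < 1 / (5 * √γ) ∧
        1 / (5 * √γ) ≤ ((D + 1 : ℕ) : ℝ) := by
      have h1 : 1 < 1 / (5 * √γ) := by rwa [lt_div_iff₀ (by positivity), one_mul]
      have h2 : 1 < ⌈1 / (5 * √γ)⌉₊ := Nat.lt_ceil.2 (by simpa using h1)
      refine ⟨⌈1 / (5 * √γ)⌉₊ - 1, by omega, ?_, ?_⟩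
      · exact Nat.lt_ceil.1 (by omega)
      · rw [Nat.sub_add_cancel h2.le]
        exact Nat.le_ceil _
    rw [lt_div_iff₀ (by positivity)] at hDlt
    have hD : (1 : ℝ) ≤ D := by exact_mod_cast hD1
    have hγD : γ * (25 * D ^ 2) < 1 := by
      have : γ * (25 * (D : ℝ) ^ 2) = (D * (5 * √γ)) ^ 2 := by
        linear_combination -(25 * (D : ℝ) ^ 2) * hss
      rw [this]
      exact pow_lt_one₀ (by positivity) hDlt (by norm_num)
    obtain ⟨n, hn, G, W, hW, A, B, d, h1, h2, h3, h4, h5, h6, h7⟩ :=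
      exists_network_of_path hγ0 hγ1 (L := 4) (by norm_num) (M := 3 * D - 1) (a := D) (Δ := D + 1)
      hD1 (by omega) (by omega) (by omega)
      (fun x hx => by
        have h1 := dotProduct_le_pathLaplacian _ x hx
        have h2 : (((3 * D - 1 : ℕ) : ℝ) + 1) = 3 * D := by
          rw [Nat.cast_sub (by omega)]
          push_cast
          ring
        rw [h2] at h1
        have h3 : 0 ≤ x ⬝ᵥ x := by simpa using dotProduct_star_self_nonneg x
        have h4 : 0 ≤ x ⬝ᵥ pathLaplacian (3 * D - 1) *ᵥ x := by
          rw [dotProduct_pathLaplacian_mulVec]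
          exact Finset.sum_nonneg fun _ _ => sq_nonneg _
        calc γ * 4 * (x ⬝ᵥ x)
            ≤ γ * 4 * ((3 * D) ^ 2 / 2 * (x ⬝ᵥ pathLaplacian (3 * D - 1) *ᵥ x)) := by gcongr
          _ = (γ * (18 * D ^ 2)) * (x ⬝ᵥ pathLaplacian (3 * D - 1) *ᵥ x) := by ring
          _ ≤ 1 * (x ⬝ᵥ pathLaplacian (3 * D - 1) *ᵥ x) := by
            refine mul_le_mul_of_nonneg_right ?_ h4
            nlinarith [mul_nonneg hγ0.le (sq_nonneg (D : ℝ))]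
          _ = _ := one_mul _)
      (dotProduct_pathLaplacian_mulVec_le _)
    exact ⟨n, hn, G, W, hW, A, B, d, D + 1, h1, h2, by omega, hDle, h3, h4, h5, h6, h7⟩

/-! ### Quadratic functions built from an involution -/

theorem hasGradientAt_of_abs_sub_le {E : Type*} [NormedAddCommGroup E] [InnerProductSpace ℝ E]
    [CompleteSpace E] {f : E → ℝ} {x g : E} {C : ℝ}
    (h : ∀ y, |f y - f x - inner ℝ g (y - x)| ≤ C * ‖y - x‖ ^ 2) : HasGradientAt f g x := by
  rw [hasGradientAt_iff_isLittleO]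
  have h1 : (fun y => f y - f x - inner ℝ g (y - x)) =O[nhds x] fun y => ‖y - x‖ ^ 2 :=
    Asymptotics.IsBigO.of_bound C (Filter.Eventually.of_forall fun y => by
      simpa using h y)
  refine h1.trans_isLittleO ?_
  have h2 : (fun z : E => ‖z‖ ^ 2) =o[nhds 0] fun z => z :=
    Asymptotics.isLittleO_norm_pow_id one_lt_two
  have h3 : Filter.Tendsto (fun y => y - x) (nhds x) (nhds 0) := by
    have : Filter.Tendsto (fun y => y - x) (nhds x) (nhds (x - x)) :=
      (continuous_id.sub continuous_const).tendsto x
    simpa using this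
  exact h2.comp_tendsto h3

/-- The quadratic function with Hessian `α + c (1 - R)` and gradient `-b` at the origin, for a
symmetric involution `R`. -/
noncomputable def swapQuad (α c : ℝ) (R : L2Seq →ₗ[ℝ] L2Seq) (b x : L2Seq) : ℝ :=
  α / 2 * ‖x‖ ^ 2 + c / 4 * ‖x - R x‖ ^ 2 - inner ℝ b x

/-- The gradient of `swapQuad α c R b`. -/
noncomputable def swapGrad (α c : ℝ) (R : L2Seq →ₗ[ℝ] L2Seq) (b x : L2Seq) : L2Seq :=
  α • x + c • (x - R x) - b

section

variable {R : L2Seq →ₗ[ℝ] L2Seq}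

theorem inner_sub_sub_of_involution (hR : ∀ x, R (R x) = x) (hs : R.IsSymmetric) (x y : L2Seq) :
    inner ℝ (x - R x) (y - R y) = 2 * inner ℝ (x - R x) y := by
  have h1 : inner ℝ (R x) (R y) = inner ℝ x y := by rw [hs, hR]
  have h2 : inner ℝ x (R y) = inner ℝ (R x) y := (hs x y).symm
  simp only [inner_sub_left, inner_sub_right, h1, h2]
  ring

theorem norm_of_involution (hR : ∀ x, R (R x) = x) (hs : R.IsSymmetric) (x : L2Seq) :
    ‖R x‖ = ‖x‖ := by
  have h1 : inner ℝ (R x) (R x) = inner ℝ x x := by rw [hs, hR]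
  rw [real_inner_self_eq_norm_sq, real_inner_self_eq_norm_sq] at h1
  exact (pow_left_inj₀ (norm_nonneg _) (norm_nonneg _) two_ne_zero).1 h1

theorem norm_sub_le_of_involution (hR : ∀ x, R (R x) = x) (hs : R.IsSymmetric) (x : L2Seq) :
    ‖x - R x‖ ≤ 2 * ‖x‖ := by
  have := norm_sub_le x (R x)
  rw [norm_of_involution hR hs] at this
  linarith

/-- The second-order expansion of `swapQuad`, which is exact. -/
theorem swapQuad_add (hR : ∀ x, R (R x) = x) (hs : R.IsSymmetric) (α c : ℝ) (b x h : L2Seq) :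
    swapQuad α c R b (x + h) =
      swapQuad α c R b x + inner ℝ (swapGrad α c R b x) h + swapQuad α c R 0 h := by
  have h1 : x + h - R (x + h) = (x - R x) + (h - R h) := by rw [map_add]; abel
  have h2 := inner_sub_sub_of_involution hR hs x h
  simp only [swapQuad, swapGrad, h1, norm_add_sq_real, h2, inner_add_left, inner_sub_left,
    inner_add_right, inner_smul_left, inner_zero_left, RCLike.conj_to_real]
  ring

theorem abs_swapQuad_zero_le (hR : ∀ x, R (R x) = x) (hs : R.IsSymmetric) (α c : ℝ) (h : L2Seq) :
    |swapQuad α c R 0 h| ≤ (|α| / 2 + |c|) * ‖h‖ ^ 2 := by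
  have h1 := norm_sub_le_of_involution hR hs h
  have h2 : ‖h - R h‖ ^ 2 ≤ 4 * ‖h‖ ^ 2 := by nlinarith [norm_nonneg (h - R h), norm_nonneg h]
  rw [swapQuad, inner_zero_left, sub_zero]
  refine (abs_add_le _ _).trans ?_
  rw [abs_mul, abs_mul, abs_div, abs_div, abs_of_nonneg (sq_nonneg ‖h‖),
    abs_of_nonneg (sq_nonneg ‖h - R h‖), abs_of_pos (two_pos : (0 : ℝ) < 2),
    abs_of_pos (four_pos : (0 : ℝ) < 4)]
  nlinarith [abs_nonneg c]

theorem hasGradientAt_swapQuad (hR : ∀ x, R (R x) = x) (hs : R.IsSymmetric) (α c : ℝ)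
    (b x : L2Seq) : HasGradientAt (swapQuad α c R b) (swapGrad α c R b x) x := by
  refine hasGradientAt_of_abs_sub_le (C := |α| / 2 + |c|) fun y => ?_
  have h1 := swapQuad_add hR hs α c b x (y - x)
  rw [add_sub_cancel] at h1
  have h2 : swapQuad α c R b y - swapQuad α c R b x - inner ℝ (swapGrad α c R b x) (y - x) =
      swapQuad α c R 0 (y - x) := by
    rw [h1]
    ring
  rw [h2]
  exact abs_swapQuad_zero_le hR hs α c _

theorem convexOn_norm_linearMap_sq {E F : Type*} [AddCommGroup E] [Module ℝ E]
    [SeminormedAddCommGroup F] [NormedSpace ℝ F] (T : E →ₗ[ℝ] F) :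
    ConvexOn ℝ Set.univ fun x => ‖T x‖ ^ 2 :=
  ((convexOn_norm (E := F) convex_univ).pow (fun _ _ => norm_nonneg _) 2).comp_linearMap T

theorem strongConvexOn_swapQuad (α : ℝ) {c : ℝ} (hc : 0 ≤ c) (b : L2Seq) :
    StrongConvexOn Set.univ α (swapQuad α c R b) := by
  rw [strongConvexOn_iff_convex]
  have h2 : ConvexOn ℝ Set.univ fun x : L2Seq => ‖x - R x‖ ^ 2 :=
    convexOn_norm_linearMap_sq (LinearMap.id - R)
  have h3 : ConvexOn ℝ Set.univ fun x : L2Seq => -inner ℝ b x :=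
    ⟨convex_univ, fun x _ y _ u v _ _ _ => le_of_eq (by
      simp only [inner_add_right, inner_smul_right, smul_eq_mul]
      ring)⟩
  have h4 : (fun x => swapQuad α c R b x - α / 2 * ‖x‖ ^ 2) =
      (fun x : L2Seq => (c / 4) • ‖x - R x‖ ^ 2) + fun x : L2Seq => -inner ℝ b x := by
    funext x
    simp only [swapQuad, smul_eq_mul, Pi.add_apply]
    ring
  rw [h4]
  exact (h2.smul (by positivity : 0 ≤ c / 4)).add h3

theorem isSmoothFun_swapQuad (hR : ∀ x, R (R x) = x) (hs : R.IsSymmetric) {α c β : ℝ}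
    (hα : 0 ≤ α) (hc : 0 ≤ c) (hβ : α + 2 * c ≤ β) (b : L2Seq) :
    IsSmoothFun β (swapQuad α c R b) := by
  refine ⟨fun x => (hasGradientAt_swapQuad hR hs α c b x).differentiableAt, fun x y => ?_⟩
  rw [(hasGradientAt_swapQuad hR hs α c b x).gradient,
    (hasGradientAt_swapQuad hR hs α c b y).gradient]
  have h1 : swapGrad α c R b x - swapGrad α c R b y =
      α • (x - y) + c • ((x - y) - R (x - y)) := by
    simp only [swapGrad, map_sub]
    module
  rw [h1]
  calc ‖α • (x - y) + c • ((x - y) - R (x - y))‖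
      ≤ α * ‖x - y‖ + c * ‖(x - y) - R (x - y)‖ := by
        refine (norm_add_le _ _).trans (le_of_eq ?_)
        rw [norm_smul, norm_smul, Real.norm_of_nonneg hα, Real.norm_of_nonneg hc]
    _ ≤ α * ‖x - y‖ + c * (2 * ‖x - y‖) := by
        gcongr
        exact norm_sub_le_of_involution hR hs _
    _ = (α + 2 * c) * ‖x - y‖ := by ring
    _ ≤ β * ‖x - y‖ := by gcongr

theorem two_mul_swapQuad_zero (hR : ∀ x, R (R x) = x) (hs : R.IsSymmetric) (α c : ℝ) (x : L2Seq) :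
    2 * swapQuad α c R 0 x = inner ℝ (swapGrad α c R 0 x) x := by
  have h := inner_sub_sub_of_involution hR hs x x
  rw [real_inner_self_eq_norm_sq] at h
  simp only [swapQuad, swapGrad, inner_add_left, inner_smul_left, inner_zero_left, sub_zero,
    RCLike.conj_to_real, real_inner_self_eq_norm_sq, h]
  ring

/-- Since `(1 - R) ^ 2 = 2 (1 - R)`, the inverse of `α + c (1 - R)` has the same form. -/
theorem swapGrad_swapGrad_inv (hR : ∀ x, R (R x) = x) {α c : ℝ} (hα : 0 < α) (hc : 0 ≤ c)
    (z : L2Seq) :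
    swapGrad α c R 0 (swapGrad (1 / α) (-(c / (α * (α + 2 * c)))) R 0 z) = z := by
  have h : α + 2 * c ≠ 0 := by positivity
  simp only [swapGrad, sub_zero, map_add, map_smul, map_sub, hR]
  match_scalars <;> field_simp <;> ring

/-- The conjugate of `swapQuad α c R b` is again a quadratic function of this kind. -/
theorem fenchelConj_swapQuad (hR : ∀ x, R (R x) = x) (hs : R.IsSymmetric) {α c : ℝ} (hα : 0 < α)
    (hc : 0 ≤ c) (b y : L2Seq) :
    fenchelConj (swapQuad α c R b) y =
      swapQuad (1 / α) (-(c / (α * (α + 2 * c)))) R 0 (y + b) := by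
  set z := y + b with hz
  set c' := -(c / (α * (α + 2 * c)))
  set s := swapGrad (1 / α) c' R 0 z with hsdef
  have hgrad : swapGrad α c R 0 s = z := swapGrad_swapGrad_inv hR hα hc z
  have hlin : ∀ x, inner ℝ y x - swapQuad α c R b x = inner ℝ z x - swapQuad α c R 0 x := by
    intro x
    simp only [swapQuad, hz, inner_add_left, inner_zero_left]
    ring
  have hval : ∀ x, inner ℝ y x - swapQuad α c R b x =
      swapQuad (1 / α) c' R 0 z - swapQuad α c R 0 (x - s) := by
    intro x
    have h1 := swapQuad_add hR hs α c 0 s (x - s)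
    rw [add_sub_cancel, hgrad, inner_sub_right] at h1
    have h2 := two_mul_swapQuad_zero hR hs α c s
    have h3 := two_mul_swapQuad_zero hR hs (1 / α) c' z
    rw [hgrad] at h2
    rw [← hsdef, real_inner_comm] at h3
    rw [hlin, h1]
    linarith
  have hle : ∀ x, inner ℝ y x - swapQuad α c R b x ≤ swapQuad (1 / α) c' R 0 z := by
    intro x
    have : 0 ≤ swapQuad α c R 0 (x - s) := by
      rw [swapQuad, inner_zero_left, sub_zero]
      positivity
    rw [hval]
    linarith
  apply le_antisymm
  · exact ciSup_le hle
  · have h1 : inner ℝ y s - swapQuad α c R b s = swapQuad (1 / α) c' R 0 z := by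
      rw [hval, sub_self]
      simp [swapQuad]
    rw [← h1]
    exact le_ciSup (f := fun x => inner ℝ y x - swapQuad α c R b x)
      ⟨_, Set.forall_mem_range.2 hle⟩ s

theorem gradient_fenchelConj_swapQuad (hR : ∀ x, R (R x) = x) (hs : R.IsSymmetric) {α c : ℝ}
    (hα : 0 < α) (hc : 0 ≤ c) (b y : L2Seq) :
    gradient (fenchelConj (swapQuad α c R b)) y =
      swapGrad (1 / α) (-(c / (α * (α + 2 * c)))) R 0 (y + b) := by
  apply HasGradientAt.gradient
  refine hasGradientAt_of_abs_sub_le (C := |1 / α| / 2 + |-(c / (α * (α + 2 * c)))|) fun x => ?_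
  rw [fenchelConj_swapQuad hR hs hα hc, fenchelConj_swapQuad hR hs hα hc]
  have h1 := swapQuad_add hR hs (1 / α) (-(c / (α * (α + 2 * c)))) 0 (y + b) (x - y)
  rw [show y + b + (x - y) = x + b by abel] at h1
  rw [h1, add_assoc, add_sub_cancel_left, add_sub_cancel_left]
  exact abs_swapQuad_zero_le hR hs _ _ _

theorem swapGrad_mem {V : Submodule ℝ L2Seq} (hV : ∀ x ∈ V, R x ∈ V) {b x : L2Seq} (hb : b ∈ V)
    (hx : x ∈ V) (α c : ℝ) : swapGrad α c R b x ∈ V :=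
  V.sub_mem (V.add_mem (V.smul_mem _ hx) (V.smul_mem _ (V.sub_mem hx (hV x hx)))) hb

/-- A local computation does not leave a subspace that contains `b` and is preserved by `R`. -/
theorem compSpan_swapQuad_le (hR : ∀ x, R (R x) = x) (hs : R.IsSymmetric) {α c : ℝ} (hα : 0 < α)
    (hc : 0 ≤ c) {b : L2Seq} {V : Submodule ℝ L2Seq} (hV : ∀ x ∈ V, R x ∈ V) (hb : b ∈ V)
    {S : Set L2Seq} (hS : S ⊆ V) : compSpan (swapQuad α c R b) S ≤ V := by
  refine Submodule.span_le.2 ?_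
  rintro x ((hx | ⟨y, hy, rfl⟩) | ⟨y, hy, rfl⟩)
  · exact hS hx
  · beta_reduce
    rw [(hasGradientAt_swapQuad hR hs α c b y).gradient]
    exact swapGrad_mem hV hb (hS hy) _ _
  · beta_reduce
    rw [gradient_fenchelConj_swapQuad hR hs hα hc]
    exact swapGrad_mem hV V.zero_mem (V.add_mem (hS hy) hb) _ _

end

/-! ### Signed swaps of coordinates -/

/-- For an involution `σ` of `ℕ`, the operator that swaps the coordinates `i` and `σ i` if they
are different and changes the sign of the coordinate `i` if `σ i = i`. -/
noncomputable def signedSwap (σ : ℕ → ℕ) (hσ : Function.Involutive σ) : L2Seq →ₗ[ℝ] L2Seq where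
  toFun x := ⟨fun i => if σ i = i then -x i else x (σ i), by
    have h1 : Summable fun i => ‖x i‖ ^ (2 : ENNReal).toReal :=
      (memℓp_gen_iff (by norm_num)).1 (lp.memℓp x)
    refine (memℓp_gen_iff (by norm_num)).2 ((h1.comp_injective hσ.injective).congr fun i => ?_)
    by_cases h : σ i = i <;> simp [h]⟩
  map_add' x y := by
    ext i
    change (if σ i = i then -(x i + y i) else x (σ i) + y (σ i)) =
      (if σ i = i then -x i else x (σ i)) + if σ i = i then -y i else y (σ i)
    split_ifs <;> ring
  map_smul' a x := by
    ext i
    by_cases h : σ i = i <;> simp [h]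

theorem signedSwap_apply (σ : ℕ → ℕ) (hσ : Function.Involutive σ) (x : L2Seq) (i : ℕ) :
    signedSwap σ hσ x i = if σ i = i then -x i else x (σ i) := rfl

theorem signedSwap_signedSwap (σ : ℕ → ℕ) (hσ : Function.Involutive σ) (x : L2Seq) :
    signedSwap σ hσ (signedSwap σ hσ x) = x := by
  ext i
  by_cases h : σ i = i
  · simp [signedSwap_apply, h]
  · simp [signedSwap_apply, h, hσ i, Ne.symm h]

theorem signedSwap_isSymmetric (σ : ℕ → ℕ) (hσ : Function.Involutive σ) :
    (signedSwap σ hσ).IsSymmetric := by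
  intro x y
  rw [lp.inner_eq_tsum, lp.inner_eq_tsum, ← (hσ.toPerm σ).tsum_eq]
  refine tsum_congr fun i => ?_
  by_cases h : σ i = i
  · simp [signedSwap_apply, h]
  · simp [signedSwap_apply, h, hσ i, Ne.symm h]

/-- The sequences that vanish from the index `k` on. -/
def supportedBelow (k : ℕ) : Submodule ℝ L2Seq where
  carrier := {x | ∀ j, k ≤ j → x j = 0}
  add_mem' hx hy j hj := by simp [hx j hj, hy j hj]
  zero_mem' j _ := rfl
  smul_mem' a x hx j hj := by simp [hx j hj]

theorem supportedBelow_mono {k l : ℕ} (h : k ≤ l) : supportedBelow k ≤ supportedBelow l :=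
  fun _ hx j hj => hx j (h.trans hj)

theorem signedSwap_mem_supportedBelow {σ : ℕ → ℕ} (hσ : Function.Involutive σ) {k : ℕ}
    (hk : ∀ j, k ≤ j → k ≤ σ j) {x : L2Seq} (hx : x ∈ supportedBelow k) :
    signedSwap σ hσ x ∈ supportedBelow k := by
  intro j hj
  rw [signedSwap_apply]
  split_ifs
  · rw [hx j hj, neg_zero]
  · exact hx _ (hk j hj)

/-- The involution of `ℕ` that exchanges `2 j` and `2 j + 1`. -/
def swapEven (i : ℕ) : ℕ := if i % 2 = 0 then i + 1 else i - 1

/-- The involution of `ℕ` that fixes `0` and exchanges `2 j + 1` and `2 j + 2`. -/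
def swapOdd (i : ℕ) : ℕ := if i = 0 then 0 else if i % 2 = 1 then i + 1 else i - 1

theorem swapEven_involutive : Function.Involutive swapEven := by
  intro i
  grind [swapEven]

theorem swapOdd_involutive : Function.Involutive swapOdd := by
  intro i
  grind [swapOdd]

theorem le_swapEven {k : ℕ} (hk : Even k) (j : ℕ) (hj : k ≤ j) : k ≤ swapEven j := by
  rw [Nat.even_iff] at hk
  unfold swapEven
  split_ifs <;> omega

theorem le_swapOdd {k : ℕ} (hk : ¬ Even k) (j : ℕ) (hj : k ≤ j) : k ≤ swapOdd j := by
  rw [Nat.even_iff] at hk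
  unfold swapOdd
  split_ifs <;> omega

/-! ### Propagation of non-zero coordinates -/

/-- The number of communications between a node at level `d` and the nodes that can make the
coordinate `k` non-zero: those at level `0` if `k` is even, those from level `Δ` on if `k` is
odd. -/
def hopsToSource (Δ k d : ℕ) : ℕ := if Even k then d else Δ - d

/-- If only nodes at level `0` can turn vectors supported below an even `k` into vectors supported
below `k + 1`, and only nodes from level `Δ` on can do so for odd `k`, then a new coordinate needs one
computation and, but for the first one, `Δ` communications. -/
theorem mem_subset_supportedBelow {n : ℕ} {W : Matrix (Fin n) (Fin n) ℝ} {τ : ℝ} (hτ : 0 < τ)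
    {f : Fin n → L2Seq → ℝ} {mem : Fin n → ℝ → Set L2Seq} {out : Fin n → ℝ → L2Seq}
    (hrun : IsBlackBoxRun W τ f mem out) {d : Fin n → ℕ} {Δ : ℕ} (hΔ : 1 ≤ Δ)
    (hd : ∀ i j, W i j ≠ 0 → d i ≤ d j + 1 ∧ d j ≤ d i + 1)
    (hf : ∀ (i : Fin n) (k : ℕ) (S : Set L2Seq), S ⊆ supportedBelow k →
      (Even k → d i ≠ 0) → (¬ Even k → d i < Δ) → compSpan (f i) S ≤ supportedBelow k)
    (t : ℝ) (k : ℕ) (i : Fin n) (ht : t < 1 + k * (1 + Δ * τ) + τ * hopsToSource Δ k (d i)) :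
    mem i t ⊆ supportedBelow k := by
  set h := min 1 τ
  have hh : 0 < h := lt_min one_pos hτ
  obtain ⟨N, hN⟩ := exists_nat_gt (t / h)
  rw [div_lt_iff₀ hh] at hN
  induction N generalizing t k i with
  | zero =>
    rw [Nat.cast_zero, zero_mul] at hN
    rw [hrun.mem_neg i t hN]
    exact Set.empty_subset _
  | succ N ih =>
    rcases lt_trichotomy t 0 with ht0 | rfl | ht0
    · rw [hrun.mem_neg i t ht0]
      exact Set.empty_subset _
    · rw [hrun.mem_zero i, Set.singleton_subset_iff]
      exact Submodule.zero_mem _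
    push_cast at hN
    have hN1 : t - 1 < N * h := by have := min_le_left 1 τ; linarith
    have hNτ : t - τ < N * h := by have := min_le_right 1 τ; linarith
    refine (hrun.mem_step i t ht0).trans (Set.union_subset ?_ ?_)
    · by_cases hk : (Even k → d i ≠ 0) ∧ (¬ Even k → d i < Δ)
      · exact hf i k _ (ih (t - 1) k i (by linarith) hN1) hk.1 hk.2
      · have hk' : Even k ∧ d i = 0 ∨ ¬ Even k ∧ Δ ≤ d i := by
          by_contra hcon
          push Not at hcon
          exact hk hcon
        have hdist : hopsToSource Δ k (d i) = 0 := by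
          unfold hopsToSource
          rcases hk' with ⟨h1, h2⟩ | ⟨h1, h2⟩
          · rw [if_pos h1, h2]
          · rw [if_neg h1]; omega
        rw [hdist, Nat.cast_zero, mul_zero, add_zero] at ht
        cases k with
        | zero =>
          have hempty : mem i (t - 1) = ∅ := hrun.mem_neg i _ (by simp at ht; linarith)
          rw [hempty]
          simp [compSpan]
        | succ k =>
          -- the previous coordinate was created at distance `Δ`
          have hdist' : Δ ≤ hopsToSource Δ k (d i) := by
            unfold hopsToSource
            rcases hk' with ⟨h1, h2⟩ | ⟨h1, h2⟩ <;> rw [Nat.even_add_one] at h1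
            · rw [if_neg h1]; omega
            · rw [if_pos (not_not.1 h1)]; omega
          have hdist'' : τ * Δ ≤ τ * hopsToSource Δ k (d i) := by gcongr
          push_cast at ht
          have hsub := ih (t - 1) k i (by linarith) hN1
          refine Set.Subset.trans ?_ (supportedBelow_mono k.le_succ)
          refine hf i k _ hsub ?_ ?_
          · rcases hk' with ⟨h1, h2⟩ | ⟨h1, h2⟩ <;> rw [Nat.even_add_one] at h1
            · exact fun h => absurd h h1
            · omega
          · rcases hk' with ⟨h1, h2⟩ | ⟨h1, h2⟩ <;> rw [Nat.even_add_one] at h1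
            · omega
            · exact fun h => absurd h h1
    · refine Submodule.span_le.2 ?_
      rintro v ⟨x, hx, rfl⟩
      refine Submodule.sum_mem _ fun j _ => ?_
      by_cases hij : W i j = 0
      · rw [hij, zero_smul]
        exact Submodule.zero_mem _
      refine Submodule.smul_mem _ _ ?_
      rcases hx j with h0 | hxj
      · rw [h0]
        exact Submodule.zero_mem _
      refine ih (t - τ) k j ?_ hNτ hxj
      have hdist : hopsToSource Δ k (d i) ≤ hopsToSource Δ k (d j) + 1 := by
        have := hd i j hij
        unfold hopsToSource
        split_ifs <;> omega
      have hdist' : τ * hopsToSource Δ k (d i) ≤ τ * (hopsToSource Δ k (d j) + 1) := by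
        have : (hopsToSource Δ k (d i) : ℝ) ≤ hopsToSource Δ k (d j) + 1 := by exact_mod_cast hdist
        gcongr
      linarith

/-- At time `t` at most `1 + t / (1 + Δ τ)` coordinates are non-zero. -/
theorem exists_supportedBelow_of_run {n : ℕ} {W : Matrix (Fin n) (Fin n) ℝ} {τ : ℝ} (hτ : 0 < τ)
    {f : Fin n → L2Seq → ℝ} {mem : Fin n → ℝ → Set L2Seq} {out : Fin n → ℝ → L2Seq}
    (hrun : IsBlackBoxRun W τ f mem out) {d : Fin n → ℕ} {Δ : ℕ} (hΔ : 1 ≤ Δ)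
    (hd : ∀ i j, W i j ≠ 0 → d i ≤ d j + 1 ∧ d j ≤ d i + 1)
    (hf : ∀ (i : Fin n) (k : ℕ) (S : Set L2Seq), S ⊆ supportedBelow k →
      (Even k → d i ≠ 0) → (¬ Even k → d i < Δ) → compSpan (f i) S ≤ supportedBelow k)
    {t : ℝ} (ht : 0 ≤ t) (i : Fin n) :
    ∃ k : ℕ, (k : ℝ) ≤ 1 + t / (1 + Δ * τ) ∧ out i t ∈ supportedBelow k := by
  have hT : 0 < 1 + Δ * τ := by positivity
  refine ⟨⌊t / (1 + Δ * τ)⌋₊ + 1, ?_, ?_⟩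
  · have := Nat.floor_le (div_nonneg ht hT.le)
    push_cast
    linarith
  · refine mem_subset_supportedBelow hτ hrun hΔ hd hf t _ i ?_ (hrun.out_mem i t ht)
    have h1 := Nat.lt_floor_add_one (t / (1 + Δ * τ))
    rw [div_lt_iff₀ hT] at h1
    have h2 : 0 ≤ τ * (hopsToSource Δ (⌊t / (1 + Δ * τ)⌋₊ + 1) (d i) : ℝ) := by positivity
    push_cast
    linarith

/-! ### The lower bound for vectors with few non-zero coordinates -/

/-- The geometric sequence with ratio `q`, as an element of `ℓ²`. -/
noncomputable def geomSeq (q : ℝ) (hq0 : 0 ≤ q) (hq1 : q < 1) : L2Seq :=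
  ⟨fun i => q ^ i, (memℓp_gen_iff (by norm_num)).2 (by
    have : Summable fun i : ℕ => (q ^ 2) ^ i :=
      summable_geometric_of_lt_one (by positivity) (pow_lt_one₀ hq0 hq1 two_ne_zero)
    refine this.congr fun i => ?_
    simp [← pow_mul, mul_comm, abs_of_nonneg hq0])⟩

@[simp] theorem geomSeq_apply {q : ℝ} (hq0 : 0 ≤ q) (hq1 : q < 1) (i : ℕ) :
    geomSeq q hq0 hq1 i = q ^ i := rfl

theorem hasSum_sq_of_L2Seq (x : L2Seq) : HasSum (fun i => x i ^ 2) (‖x‖ ^ 2) := by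
  have := lp.hasSum_inner (𝕜 := ℝ) x x
  rw [real_inner_self_eq_norm_sq] at this
  refine this.congr_fun fun i => ?_
  simp [sq]

theorem norm_geomSeq_sq {q : ℝ} (hq0 : 0 ≤ q) (hq1 : q < 1) :
    ‖geomSeq q hq0 hq1‖ ^ 2 = 1 / (1 - q ^ 2) := by
  have h1 := hasSum_sq_of_L2Seq (geomSeq q hq0 hq1)
  have h2 := hasSum_geometric_of_lt_one (sq_nonneg q) (pow_lt_one₀ hq0 hq1 two_ne_zero)
  rw [one_div]
  refine h1.unique (h2.congr_fun fun i => ?_)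
  simp [← pow_mul, mul_comm]

/-- The squared difference of consecutive coordinates; before the coordinate `0` stands its
opposite, because `signedSwap swapOdd` changes its sign. -/
def gapSq (x : ℕ → ℝ) : ℕ → ℝ
  | 0 => 4 * x 0 ^ 2
  | i + 1 => (x i - x (i + 1)) ^ 2

theorem sq_add_sq_eq_gapSq (x : L2Seq) (i : ℕ) :
    (x - signedSwap swapOdd swapOdd_involutive x) i ^ 2 +
      (x - signedSwap swapEven swapEven_involutive x) i ^ 2 = gapSq x i + gapSq x (i + 1) := by
  rw [lp.coeFn_sub, lp.coeFn_sub, Pi.sub_apply, Pi.sub_apply, signedSwap_apply, signedSwap_apply]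
  rcases i with _ | i
  · simp [swapOdd, swapEven, gapSq]
    ring
  · rcases Nat.mod_two_eq_zero_or_one i with h | h
    · have h1 : (i + 1) % 2 = 1 := by omega
      simp [swapOdd, swapEven, gapSq, h1]
      ring
    · have h1 : (i + 1) % 2 = 0 := by omega
      simp [swapOdd, swapEven, gapSq, h1]
      ring

/-- The quadratic part of twice the global objective: `α` times the squared norm plus `δ` times the
sum of `2 (x 0) ^ 2` and of all squared differences of consecutive coordinates. -/
noncomputable def globalForm (α δ : ℝ) (x : L2Seq) : ℝ :=
  α * ‖x‖ ^ 2 + δ / 2 * (‖x - signedSwap swapOdd swapOdd_involutive x‖ ^ 2 +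
    ‖x - signedSwap swapEven swapEven_involutive x‖ ^ 2)

theorem hasSum_globalForm (α δ : ℝ) (x : L2Seq) :
    HasSum (fun i => α * x i ^ 2 + δ / 2 * (gapSq x i + gapSq x (i + 1))) (globalForm α δ x) := by
  refine (((hasSum_sq_of_L2Seq x).mul_left α).add
    (((hasSum_sq_of_L2Seq (x - signedSwap swapOdd swapOdd_involutive x)).add
      (hasSum_sq_of_L2Seq (x - signedSwap swapEven swapEven_involutive x))).mul_left
      (δ / 2))).congr_fun fun i => ?_
  rw [sq_add_sq_eq_gapSq]

/-- The energy of the first `m` coordinates when the coordinate `m` is prescribed. The constant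
`α q / (1 - q)` is the fixed point of the recursion that adds one coordinate. -/
theorem le_sum_globalForm {α q : ℝ} (hα : 0 ≤ α) (hq0 : 0 ≤ q) (hq1 : q < 1) (x : ℕ → ℝ) (m : ℕ) :
    α * q / (1 - q) * x m ^ 2 - α * q / (1 - q) ^ 2 / 2 * gapSq x m ≤
      ∑ i ∈ Finset.range m,
        (α * x i ^ 2 + α * q / (1 - q) ^ 2 / 2 * (gapSq x i + gapSq x (i + 1))) := by
  have h1q : 0 < 1 - q := by linarith
  induction m with
  | zero =>
    have h : α * q / (1 - q) * x 0 ^ 2 - α * q / (1 - q) ^ 2 / 2 * (4 * x 0 ^ 2) =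
        -(α * q * (1 + q) / (1 - q) ^ 2 * x 0 ^ 2) := by
      field_simp
      ring
    simp only [Finset.range_zero, Finset.sum_empty, gapSq]
    rw [h, neg_nonpos]
    positivity
  | succ m ih =>
    rw [Finset.sum_range_succ]
    have h : α * q / (1 - q) * x m ^ 2 + α * x m ^ 2 + α * q / (1 - q) ^ 2 * (x m - x (m + 1)) ^ 2 -
        α * q / (1 - q) * x (m + 1) ^ 2 = α / (1 - q) ^ 2 * (x m - q * x (m + 1)) ^ 2 := by
      field_simp
      ring
    have h2 : 0 ≤ α / (1 - q) ^ 2 * (x m - q * x (m + 1)) ^ 2 := by positivity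
    have h3 : gapSq x (m + 1) = (x m - x (m + 1)) ^ 2 := rfl
    rw [← h3] at h
    linarith

/-- The energy of a vector that coincides with the opposite of the geometric sequence from the
coordinate `k` on: the coordinates below `k` are bounded by `le_sum_globalForm`, those above are
summed exactly. -/
theorem le_globalForm {α q : ℝ} (hα : 0 ≤ α) (hq0 : 0 ≤ q) (hq1 : q < 1) {x : L2Seq} {k : ℕ}
    (hx : ∀ i, k ≤ i → x i = -q ^ i) :
    α * (1 + q) ^ 2 * q ^ (2 * k) * (1 / (1 - q ^ 2)) ≤ globalForm α (α * q / (1 - q) ^ 2) x := by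
  have h1q : 0 < 1 - q := by linarith
  have h1q2 : 0 < 1 - q ^ 2 := by nlinarith
  set δ := α * q / (1 - q) ^ 2 with hδ
  have hδq : δ * (1 - q) ^ 2 = α * q := by rw [hδ]; field_simp
  have hgap : ∀ i, k ≤ i → gapSq x (i + 1) = (1 - q) ^ 2 * q ^ (2 * i) := by
    intro i hi
    rw [gapSq, hx i hi, hx (i + 1) (by omega)]
    ring
  have htail : HasSum (fun j => α * x (j + (k + 1)) ^ 2 +
      δ / 2 * (gapSq x (j + (k + 1)) + gapSq x (j + (k + 1) + 1)))
      (α * q ^ (2 * k) * (q ^ 2 + q / 2 * (1 + q ^ 2)) * (1 - q ^ 2)⁻¹) := by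
    have h2 := (hasSum_geometric_of_lt_one (sq_nonneg q)
      (pow_lt_one₀ hq0 hq1 two_ne_zero)).mul_left
      (α * q ^ (2 * k) * (q ^ 2 + q / 2 * (1 + q ^ 2)))
    refine h2.congr_fun fun j => ?_
    rw [hgap _ (by omega), ← add_assoc j k 1, hgap _ (by omega), hx _ (by omega)]
    linear_combination (q ^ (2 * (j + k)) + q ^ (2 * (j + k + 1))) / 2 * hδq
  have hP := (hasSum_globalForm α δ x).unique ((hasSum_nat_add_iff (k + 1)).1 htail)
  have hhead := le_sum_globalForm hα hq0 hq1 x k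
  rw [← hδ] at hhead
  rw [hP, Finset.sum_range_succ, hgap k le_rfl]
  have hxk : x k ^ 2 = q ^ (2 * k) := by rw [hx k le_rfl]; ring
  rw [hxk] at hhead ⊢
  have hident : α * q / (1 - q) * q ^ (2 * k) + α * q ^ (2 * k) + α * q / 2 * q ^ (2 * k) +
      α * q ^ (2 * k) * (q ^ 2 + q / 2 * (1 + q ^ 2)) * (1 - q ^ 2)⁻¹ =
      α * (1 + q) ^ 2 * q ^ (2 * k) * (1 / (1 - q ^ 2)) := by
    have h3 : 1 - q ^ 2 = (1 - q) * (1 + q) := by ring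
    have h4 : 0 < 1 + q := by linarith
    rw [h3]
    field_simp
    ring
  have h5 : δ / 2 * ((1 - q) ^ 2 * q ^ (2 * k)) = α * q / 2 * q ^ (2 * k) := by
    linear_combination q ^ (2 * k) / 2 * hδq
  rw [mul_add (δ / 2), h5]
  linarith

/-! ### The local functions -/

/-- The local functions: the pairs `(2 j + 1, 2 j + 2)` of coordinates are coupled by the nodes in
`A`, which also hold the linear term, the pairs `(2 j, 2 j + 1)` by those in `B`. The weights make
the average independent of the sizes of `A` and `B`. -/
noncomputable def localFun {n : ℕ} (A B : Finset (Fin n)) (α δ : ℝ) (b : L2Seq) (i : Fin n) :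
    L2Seq → ℝ :=
  if i ∈ A then swapQuad α (n / A.card * δ) (signedSwap swapOdd swapOdd_involutive)
    (((n : ℝ) / A.card) • b)
  else if i ∈ B then swapQuad α (n / B.card * δ) (signedSwap swapEven swapEven_involutive) 0
  else swapQuad α 0 (signedSwap swapEven swapEven_involutive) 0

theorem avgFun_localFun {n : ℕ} {A B : Finset (Fin n)} (hAB : Disjoint A B) (hA : A.Nonempty)
    (hB : B.Nonempty) (α δ : ℝ) (b x : L2Seq) :
    avgFun (localFun A B α δ b) x =
      swapQuad α δ (signedSwap swapOdd swapOdd_involutive) b x +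
        swapQuad 0 δ (signedSwap swapEven swapEven_involutive) 0 x := by
  set P := ‖x - signedSwap swapOdd swapOdd_involutive x‖ ^ 2 with hP
  set Q := ‖x - signedSwap swapEven swapEven_involutive x‖ ^ 2 with hQ
  have hA0 : (A.card : ℝ) ≠ 0 := by exact_mod_cast hA.card_ne_zero
  have hB0 : (B.card : ℝ) ≠ 0 := by exact_mod_cast hB.card_ne_zero
  have hn0 : (n : ℝ) ≠ 0 := by
    obtain ⟨i, -⟩ := hA
    have := i.2
    have : n ≠ 0 := by omega
    exact_mod_cast this
  have hloc : ∀ i, localFun A B α δ b i x = α / 2 * ‖x‖ ^ 2 +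
      (if i ∈ A then n / A.card * (δ / 4 * P - inner ℝ b x) else 0) +
      if i ∈ B then n / B.card * (δ / 4 * Q) else 0 := by
    intro i
    unfold localFun
    by_cases hi : i ∈ A
    · have hiB : i ∉ B := Finset.disjoint_left.1 hAB hi
      rw [if_pos hi, if_pos hi, if_neg hiB, swapQuad, inner_smul_left, RCLike.conj_to_real, ← hP]
      ring
    · by_cases hiB : i ∈ B
      · rw [if_neg hi, if_neg hi, if_pos hiB, if_pos hiB, swapQuad, inner_zero_left, ← hQ]
        ring
      · rw [if_neg hi, if_neg hi, if_neg hiB, if_neg hiB, swapQuad, inner_zero_left]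
        ring
  simp only [avgFun, hloc, Finset.sum_add_distrib, Finset.sum_ite_mem, Finset.univ_inter,
    Finset.sum_const, Finset.card_univ, Fintype.card_fin, nsmul_eq_mul, swapQuad, inner_zero_left,
    ← hP, ← hQ]
  field_simp
  ring

/-- The gradient of the global objective vanishes at the geometric sequence. -/
theorem swapGrad_geomSeq {α q : ℝ} (hq0 : 0 ≤ q) (hq1 : q < 1) :
    swapGrad α (α * q / (1 - q) ^ 2) (signedSwap swapOdd swapOdd_involutive)
        ((α + α * q / (1 - q) ^ 2 * (3 - q)) • geomSeq 0 le_rfl one_pos) (geomSeq q hq0 hq1) +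
      swapGrad 0 (α * q / (1 - q) ^ 2) (signedSwap swapEven swapEven_involutive) 0
        (geomSeq q hq0 hq1) = 0 := by
  have h1q : 1 - q ≠ 0 := by linarith
  set δ := α * q / (1 - q) ^ 2 with hδ
  have hδq : δ * (1 - q) ^ 2 = α * q := by rw [hδ]; field_simp
  ext i
  simp only [swapGrad, lp.coeFn_add, lp.coeFn_sub, lp.coeFn_smul, lp.coeFn_zero, Pi.add_apply,
    Pi.sub_apply, Pi.smul_apply, Pi.zero_apply, signedSwap_apply, geomSeq_apply, smul_eq_mul]
  rcases i with _ | i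
  · simp [swapOdd, swapEven]
    ring
  · rcases Nat.mod_two_eq_zero_or_one i with h | h
    · have h1 : (i + 1) % 2 = 1 := by omega
      simp [swapOdd, swapEven, h1]
      linear_combination -(q ^ i) * hδq
    · have h1 : (i + 1) % 2 = 0 := by omega
      simp [swapOdd, swapEven, h1]
      linear_combination -(q ^ i) * hδq

theorem avgFun_localFun_sub {n : ℕ} {A B : Finset (Fin n)} (hAB : Disjoint A B) (hA : A.Nonempty)
    (hB : B.Nonempty) {α q : ℝ} (hq0 : 0 ≤ q) (hq1 : q < 1) (x : L2Seq) :
    avgFun (localFun A B α (α * q / (1 - q) ^ 2)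
        ((α + α * q / (1 - q) ^ 2 * (3 - q)) • geomSeq 0 le_rfl one_pos)) x -
      avgFun (localFun A B α (α * q / (1 - q) ^ 2)
        ((α + α * q / (1 - q) ^ 2 * (3 - q)) • geomSeq 0 le_rfl one_pos)) (geomSeq q hq0 hq1) =
      1 / 2 * globalForm α (α * q / (1 - q) ^ 2) (x - geomSeq q hq0 hq1) := by
  have hgrad := swapGrad_geomSeq (α := α) hq0 hq1
  rw [avgFun_localFun hAB hA hB, avgFun_localFun hAB hA hB]
  set b := (α + α * q / (1 - q) ^ 2 * (3 - q)) • geomSeq 0 le_rfl one_pos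
  set δ := α * q / (1 - q) ^ 2
  set θ := geomSeq q hq0 hq1
  have h1 := swapQuad_add (signedSwap_signedSwap swapOdd swapOdd_involutive)
    (signedSwap_isSymmetric swapOdd swapOdd_involutive) α δ b θ (x - θ)
  have h2 := swapQuad_add (signedSwap_signedSwap swapEven swapEven_involutive)
    (signedSwap_isSymmetric swapEven swapEven_involutive) 0 δ 0 θ (x - θ)
  have h3 := congrArg (fun y => inner ℝ y (x - θ)) hgrad
  simp only [inner_add_left, inner_zero_left] at h3
  rw [add_sub_cancel] at h1 h2
  rw [h1, h2]
  have h4 : swapQuad α δ (signedSwap swapOdd swapOdd_involutive) 0 (x - θ) +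
      swapQuad 0 δ (signedSwap swapEven swapEven_involutive) 0 (x - θ) =
      1 / 2 * globalForm α δ (x - θ) := by
    simp only [swapQuad, globalForm, inner_zero_left]
    ring
  linarith

theorem geomSeq_zero_mem_supportedBelow {k : ℕ} (hk : 1 ≤ k) :
    geomSeq 0 le_rfl one_pos ∈ supportedBelow k := fun j hj => by
  rw [geomSeq_apply, zero_pow (by omega)]

/-- Only the nodes in `A` can leave the vectors supported below an even index, and only those in
`B` can leave those supported below an odd one. -/
theorem compSpan_localFun_le {n : ℕ} {A B : Finset (Fin n)} {α δ a : ℝ} (hα : 0 < α) (hδ : 0 ≤ δ)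
    (i : Fin n) {k : ℕ} (hA : Even k → i ∉ A) (hB : ¬ Even k → i ∉ B) {S : Set L2Seq}
    (hS : S ⊆ supportedBelow k) :
    compSpan (localFun A B α δ (a • geomSeq 0 le_rfl one_pos) i) S ≤ supportedBelow k := by
  have hO := signedSwap_signedSwap swapOdd swapOdd_involutive
  have hO' := signedSwap_isSymmetric swapOdd swapOdd_involutive
  have hE := signedSwap_signedSwap swapEven swapEven_involutive
  have hE' := signedSwap_isSymmetric swapEven swapEven_involutive
  unfold localFun
  by_cases hiA : i ∈ A
  · have hk : ¬ Even k := fun h => hA h hiA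
    rw [if_pos hiA]
    refine compSpan_swapQuad_le hO hO' hα (by positivity)
      (fun x hx => signedSwap_mem_supportedBelow _ (le_swapOdd hk) hx) ?_ hS
    refine Submodule.smul_mem _ _ (Submodule.smul_mem _ _ (geomSeq_zero_mem_supportedBelow ?_))
    rcases k with _ | k
    · simp at hk
    · omega
  rw [if_neg hiA]
  by_cases hiB : i ∈ B
  · have hk : Even k := by
      by_contra h
      exact hB h hiB
    rw [if_pos hiB]
    exact compSpan_swapQuad_le hE hE' hα (by positivity)
      (fun x hx => signedSwap_mem_supportedBelow _ (le_swapEven hk) hx) (Submodule.zero_mem _) hS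
  · rw [if_neg hiB]
    -- with `c = 0` and `b = 0` the involution does not matter
    by_cases hk : Even k
    · exact compSpan_swapQuad_le hE hE' hα le_rfl
        (fun x hx => signedSwap_mem_supportedBelow _ (le_swapEven hk) hx) (Submodule.zero_mem _) hS
    · have : swapQuad α 0 (signedSwap swapEven swapEven_involutive) 0 =
          swapQuad α 0 (signedSwap swapOdd swapOdd_involutive) 0 := by
        funext x
        simp [swapQuad]
      rw [this]
      exact compSpan_swapQuad_le hO hO' hα le_rfl
        (fun x hx => signedSwap_mem_supportedBelow _ (le_swapOdd hk) hx) (Submodule.zero_mem _) hS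

theorem localFun_strongConvexOn_and_isSmoothFun {n : ℕ} {A B : Finset (Fin n)} {α β δ : ℝ}
    (hα : 0 ≤ α) (hδ : 0 ≤ δ) (hβ : α + 8 * δ ≤ β) (hA : n ≤ 4 * A.card) (hB : n ≤ 4 * B.card)
    (b : L2Seq) (i : Fin n) :
    StrongConvexOn Set.univ α (localFun A B α δ b i) ∧ IsSmoothFun β (localFun A B α δ b i) := by
  have hn := i.2
  have hle : ∀ C : Finset (Fin n), n ≤ 4 * C.card → α + 2 * (n / C.card * δ) ≤ β := by
    intro C hC
    have hC0 : (0 : ℝ) < C.card := by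
      have : 0 < C.card := by omega
      exact_mod_cast this
    have h4 : (n : ℝ) / C.card ≤ 4 := by
      rw [div_le_iff₀ hC0]
      exact_mod_cast hC
    nlinarith
  unfold localFun
  split_ifs
  · exact ⟨strongConvexOn_swapQuad α (by positivity) _, isSmoothFun_swapQuad
      (signedSwap_signedSwap _ _) (signedSwap_isSymmetric _ _) hα (by positivity) (hle A hA) _⟩
  · exact ⟨strongConvexOn_swapQuad α (by positivity) _, isSmoothFun_swapQuad
      (signedSwap_signedSwap _ _) (signedSwap_isSymmetric _ _) hα (by positivity) (hle B hB) _⟩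
  · exact ⟨strongConvexOn_swapQuad α le_rfl _, isSmoothFun_swapQuad
      (signedSwap_signedSwap _ _) (signedSwap_isSymmetric _ _) hα le_rfl (by linarith) _⟩

/-! ### The choice of the ratio -/

/-- The ratio `1 - 4 / √κ` satisfies the smoothness constraint on the local functions, and its
fourth power dominates `1 - 16 / √κ`. -/
theorem exists_ratio {α β : ℝ} (hα : 0 < α) (hαβ : α ≤ β) :
    ∃ q : ℝ, 0 ≤ q ∧ q < 1 ∧ α + 8 * (α * q / (1 - q) ^ 2) ≤ β ∧
      (1 - 16 / √(β / α) ≤ 0 ∨ 1 - 16 / √(β / α) ≤ q ^ 4 ∧ 3 ≤ (1 + q) ^ 2) := by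
  set r := √(β / α) with hr
  have hκ : 1 ≤ β / α := by rwa [one_le_div hα]
  have hr0 : 0 < r := Real.sqrt_pos.2 (by linarith)
  have hrr : α * r ^ 2 = β := by
    rw [hr, Real.sq_sqrt (by linarith)]
    field_simp
  by_cases h16 : r ≤ 16
  · refine ⟨0, le_rfl, one_pos, by simpa using hαβ, Or.inl ?_⟩
    have : 1 ≤ 16 / r := by rwa [one_le_div hr0]
    linarith
  push Not at h16
  obtain ⟨e, he⟩ : ∃ e, e = 4 / r := ⟨_, rfl⟩
  have her : e * r = 4 := by rw [he]; field_simp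
  have he0 : 0 < e := by rw [he]; positivity
  have he1 : e < 1 / 4 := by rw [he, div_lt_iff₀ hr0]; linarith
  refine ⟨1 - e, by linarith, by linarith, ?_, Or.inr ⟨?_, by nlinarith⟩⟩
  · have h1 : α * (1 - e) / (1 - (1 - e)) ^ 2 = α * (1 - e) * r ^ 2 / 16 := by
      rw [sub_sub_cancel, div_eq_iff (by positivity)]
      linear_combination -(α * (1 - e) * (e * r + 4) / 16) * her
    have h2 : α * (1 - e) * r ^ 2 / 16 = β / 16 - β * e / 16 := by
      rw [← hrr]
      ring
    have h3 : 0 ≤ β * e := by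
      have : 0 < β := by linarith
      positivity
    have h4 : 256 * α ≤ β := by
      have : 256 ≤ r ^ 2 := by nlinarith
      rw [← hrr]
      nlinarith
    rw [h1, h2]
    linarith
  · have h1 : 16 / r = 4 * e := by rw [he]; ring
    rw [h1]
    have := one_add_mul_le_pow (a := -e) (by linarith) 4
    push_cast at this
    rw [← sub_eq_add_neg] at this
    linarith

/-- The rate in terms of the number `k` of non-zero coordinates. -/
theorem rpow_rate_le {q ρ s g Δ τ t : ℝ} {k : ℕ} (hq0 : 0 ≤ q)
    (hρ : ρ ≤ 0 ∨ ρ ≤ q ^ 4 ∧ 3 ≤ (1 + q) ^ 2) (hq1 : q < 1) (hs : 0 < s) (hg : 1 / s ≤ Δ)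
    (hτ : 0 < τ) (ht : 0 ≤ t) (hk : k ≤ 1 + t / (1 + Δ * τ)) (hgs : g = 1 + t / (1 + τ / s)) :
    3 * max 0 ρ ^ g ≤ (1 + q) ^ 2 * q ^ (2 * k) := by
  have hg0 : 0 < g := by rw [hgs]; positivity
  rcases le_or_gt ρ 0 with h0 | h0
  · rw [max_eq_left h0, Real.zero_rpow hg0.ne', mul_zero]
    positivity
  obtain ⟨h1, h2⟩ := hρ.resolve_left h0.not_ge
  rw [max_eq_right h0.le]
  have hq4 : q ^ 4 ≤ q ^ 2 := pow_le_pow_of_le_one hq0 hq1.le (by norm_num)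
  have hkg : (k : ℝ) ≤ g := by
    refine hk.trans ?_
    rw [hgs]
    have : τ / s ≤ Δ * τ := by
      rw [div_eq_mul_one_div, mul_comm]
      gcongr
    gcongr
  have h3 : ρ ^ g ≤ q ^ (2 * k) := by
    calc ρ ^ g ≤ ρ ^ (k : ℝ) :=
          Real.rpow_le_rpow_of_exponent_ge h0
            (h1.trans (pow_le_one₀ hq0 hq1.le)) hkg
      _ = ρ ^ k := Real.rpow_natCast _ _
      _ ≤ (q ^ 2) ^ k := by gcongr; linarith
      _ = q ^ (2 * k) := by rw [← pow_mul]
  have h4 : 0 ≤ q ^ (2 * k) := by positivity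
  nlinarith

theorem theorem2 (α β γ : ℝ) (hα : 0 < α) (hαβ : α ≤ β) (hγ0 : 0 < γ) (hγ1 : γ ≤ 1) :
    ∃ (n : ℕ) (hn : 2 ≤ n) (G : SimpleGraph (Fin n)) (W : Matrix (Fin n) (Fin n) ℝ)
      (hW : IsGossipMatrix G W) (f : Fin n → L2Seq → ℝ) (θopt : L2Seq),
      G.Connected ∧
      eigengap hn hW.isHermitian = γ ∧
      (∀ i, StrongConvexOn Set.univ α (f i)) ∧
      (∀ i, IsSmoothFun β (f i)) ∧
      (∀ x, avgFun f θopt ≤ avgFun f x) ∧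
      θopt ≠ 0 ∧
      ∀ τ : ℝ, 0 < τ →
        ∀ (mem : Fin n → ℝ → Set L2Seq) (out : Fin n → ℝ → L2Seq),
          IsBlackBoxRun W τ f mem out →
          ∀ t : ℝ, 0 ≤ t → ∀ i : Fin n,
            avgFun f (out i t) - avgFun f θopt ≥
              (3 * α / 2) *
                (max 0 (1 - 16 / Real.sqrt (β / α))) ^ (1 + t / (1 + τ / (5 * Real.sqrt γ))) *
                ‖out i 0 - θopt‖ ^ 2 := by
  obtain ⟨n, hn, G, W, hW, A, B, d, Δ, hG, hgap, hΔ, hΔγ, hA, hB, hdA, hdB, hd⟩ :=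
    exists_network hγ0 hγ1
  obtain ⟨q, hq0, hq1, hqβ, hqρ⟩ := exists_ratio hα hαβ
  have hAne : A.Nonempty := Finset.card_pos.1 (by omega)
  have hBne : B.Nonempty := Finset.card_pos.1 (by omega)
  have hAB : Disjoint A B := Finset.disjoint_left.2 fun i hi hi' => by
    have := hdA i hi
    have := hdB i hi'
    omega
  have h1q : 0 < 1 - q := by linarith
  have hδ : 0 ≤ α * q / (1 - q) ^ 2 := by positivity
  have hsub := avgFun_localFun_sub hAB hAne hBne (α := α) hq0 hq1
  set b := (α + α * q / (1 - q) ^ 2 * (3 - q)) • geomSeq 0 le_rfl one_pos with hb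
  set θ := geomSeq q hq0 hq1 with hθ
  have hf := localFun_strongConvexOn_and_isSmoothFun hα.le hδ hqβ hA hB b
  refine ⟨n, hn, G, W, hW, localFun A B α (α * q / (1 - q) ^ 2) b, θ, hG, hgap,
    fun i => (hf i).1, fun i => (hf i).2, fun x => ?_, fun h => ?_, ?_⟩
  · have h1 := hsub x
    have h2 : 0 ≤ globalForm α (α * q / (1 - q) ^ 2) (x - θ) := by
      unfold globalForm
      positivity
    linarith
  · have h0 : θ 0 = (0 : L2Seq) 0 := by rw [h]
    simp [hθ] at h0
  · intro τ hτ mem out hrun t ht i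
    obtain ⟨k, hk, hmem⟩ := exists_supportedBelow_of_run hτ hrun hΔ hd
      (fun i k S hS h1 h2 => compSpan_localFun_le hα hδ i
        (fun hk hi => h1 hk (hdA i hi))
        (fun hk hi => (h2 hk).not_ge (hdB i hi)) hS) ht i
    have hout0 : out i 0 = 0 := by
      have h0 := hrun.out_mem i 0 le_rfl
      rwa [hrun.mem_zero i, Set.mem_singleton_iff] at h0
    have hlow := le_globalForm hα.le hq0 hq1 (x := out i t - θ) (k := k) fun j hj => by
      rw [lp.coeFn_sub, Pi.sub_apply, hmem j hj, hθ, geomSeq_apply, zero_sub]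
    have hrate := rpow_rate_le hq0 hqρ hq1 (by positivity) hΔγ hτ ht hk rfl
    rw [hsub, hout0, zero_sub, norm_neg, hθ, norm_geomSeq_sq]
    have hpos : 0 < 1 - q ^ 2 := by nlinarith
    have hN : 0 ≤ α / 2 * (1 / (1 - q ^ 2)) := by positivity
    have := mul_le_mul_of_nonneg_left hrate hN
    rw [← hθ]
    linarith
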